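/- Let $U\subseteq\mathbb C$ be a non-empty connected open set and let $u_N$, $N\in\mathbb Z^2$, be independent variables ranging over $U$; write $u=u_{(0,0)}$. Let $\mathcal M_U$ be the field of fractions of the algebra of functions that are holomorphic in finitely many of the $u_N\in U$. It carries the commuting partial derivatives $\partial/\partial u_N$ and the commuting automorphisms $\mathcal S_1,\mathcal S_2$ with $\mathcal S_1u_{(m,n)}=u_{(m+1,n)}$, $\mathcal S_2u_{(m,n)}=u_{(m,n+1)}$; put $\mathcal S^{(m,n)}=\mathcal S_1^m\mathcal S_2^n$. Let $\mathcal A$ be an algebra of difference functions contained in $\mathcal M_U$, i.e. a $\mathbb C$-subalgebra of $\mathcal M_U$ that contains all $u_N$ and is stable under the $\partial/\partial u_N$ and under $\mathcal S_1^{\pm1},\mathcal S_2^{\pm1}$ (for example $\mathbb C[u_N:N\in\mathbb Z^2]$ or $\mathcal M_U$ itself). Difference operators over $\mathcal A$ are finite sums $P=\sum_{L\in\mathbb Z^2}P_L\mathcal S^L$, $P_L\in\mathcal A$, multiplied by the rule $\mathcal S^L\circ a=\mathcal S^L(a)\,\mathcal S^L$ and acting on $\mathcal A$ by $P(a)=\sum_LP_L\,\mathcal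 S^L(a)$. Let $\mathcal F=\mathcal A/\big((\mathcal S_1-1)\mathcal A+(\mathcal S_2-1)\mathcal A\big)$ be the space of local functionals, $\int:\mathcal A\to\mathcal F$ the projection, and $\frac{\delta}{\delta u}\int a=\sum_N\mathcal S^{-N}\frac{\partial a}{\partial u_N}$ the variational derivative. The operator $P$ is called Hamiltonian if $\{F,G\}=\int\frac{\delta G}{\delta u}\,P\big(\frac{\delta F}{\delta u}\big)$ is a Lie bracket on $\mathcal F$ and $F\mapsto X_F=\sum_N\mathcal S^N\big(P\big(\tfrac{\delta F}{\delta u}\big)\big)\frac{\partial}{\partial u_N}$ satisfies $X_{\{F,G\}}=[X_F,X_G]$ on $\mathcal A$ for all $F,G\in\mathcal F$. Proposition. Let $f,g\in\mathcal A$. The skew-adjoint operator $$P=f\,\mathcal S_1+g\,\mathcal S_2-\mathcal S_2^{-1}\circ g-\mathcal S_1^{-1}\circ f$$ is Hamiltonian if and only if there are constants $\alpha,\beta\in\mathbb C$ and a function $\varphi=\varphi(u)\in\mathcal M_U$ of the single variable $u$ (i.e. $\partial\varphi/\partial u_N=0$ for all $N\ne(0,0)$) such that $$P=\varphi(u)\,\big(\alpha\,\mathcal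 S_1+\beta\,\mathcal S_2-\beta\,\mathcal S_2^{-1}-\alpha\,\mathcal S_1^{-1}\big)\circ\varphi(u).$$ -/

import Mathlib

open scoped Topology

noncomputable section

/-! ## Algebras of difference functions in one generator with two commuting shifts -/

/-- An algebra of difference functions in one variable `u` on the lattice `ℤ²`: a commutative
`ℂ`-algebra extending the polynomial algebra in the variables `u_N`, `N ∈ ℤ²`, with commuting
automorphisms `𝓢^N` (generated by the two shifts) such that `𝓢^N u = u_N`, and with commuting
partial derivatives `∂/∂u_M` compatible with the shifts, only finitely many of which are nonzero
on a given element. -/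
class DifferenceAlgebra (A : Type*) [CommRing A] [Algebra ℂ A] where
  shiftHom : Multiplicative (ℤ × ℤ) →* (A ≃ₐ[ℂ] A)
  gen : A
  pd : ℤ × ℤ → Derivation ℂ A A
  algebraicIndependent :
    AlgebraicIndependent ℂ fun N : ℤ × ℤ => shiftHom (Multiplicative.ofAdd N) gen
  pd_gen : ∀ M N : ℤ × ℤ,
    pd M (shiftHom (Multiplicative.ofAdd N) gen) = if M = N then 1 else 0
  pd_comm : ∀ (M N : ℤ × ℤ) (a : A), pd M (pd N a) = pd N (pd M a)
  pd_finite : ∀ a : A, {N : ℤ × ℤ | pd N a ≠ 0}.Finite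
  pd_shift : ∀ (M N : ℤ × ℤ) (a : A),
    pd M (shiftHom (Multiplicative.ofAdd N) a) = shiftHom (Multiplicative.ofAdd N) (pd (M - N) a)

namespace DifferenceAlgebra

section General

variable {A : Type*} [CommRing A] [Algebra ℂ A] [DifferenceAlgebra A]

/-- The shift `𝓢^N = 𝓢₁^{n₁} 𝓢₂^{n₂}` as an automorphism of `A`. -/
def shift (N : ℤ × ℤ) : A ≃ₐ[ℂ] A := shiftHom (Multiplicative.ofAdd N)

theorem shift_add (M N : ℤ × ℤ) (a : A) : shift (M + N) a = shift M (shift N a) := by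
  simp [shift, ofAdd_add, map_mul]

theorem shift_zero (a : A) : shift (0 : ℤ × ℤ) a = a := by
  simp [shift]

theorem pd_shift' (M N : ℤ × ℤ) (a : A) : pd M (shift N a) = shift N (pd (M - N) a) :=
  pd_shift M N a

variable (A) in
/-- The subspace `Δ₁ A + Δ₂ A`, where `Δ_α = 𝓢_α - 1`. -/
def totalDifferences : Submodule ℂ A :=
  LinearMap.range ((shift (1, 0) : A ≃ₐ[ℂ] A).toLinearMap - LinearMap.id) ⊔
    LinearMap.range ((shift (0, 1) : A ≃ₐ[ℂ] A).toLinearMap - LinearMap.id)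

variable (A) in
/-- The space `𝓕 = A / (Δ₁ A + Δ₂ A)` of local functionals. -/
abbrev LocalFunctional : Type _ := A ⧸ totalDifferences A

/-- The formal integral `∫ : A → 𝓕`. -/
def integral : A →ₗ[ℂ] LocalFunctional A := (totalDifferences A).mkQ

theorem finite_support_shift_pd (a : A) :
    (Function.support fun N : ℤ × ℤ => shift (-N) (pd N a)).Finite :=
  (pd_finite a).subset fun N hN => by
    intro h
    apply hN
    simp [h]

/-- The variational derivative `∑_N 𝓢^{-N} ∂a/∂u_N` of a density `a`. -/
def varDerDensity : A →ₗ[ℂ] A where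
  toFun a := ∑ᶠ N : ℤ × ℤ, shift (-N) (pd N a)
  map_add' a b := by
    rw [← finsum_add_distrib (finite_support_shift_pd a) (finite_support_shift_pd b)]
    simp
  map_smul' c a := by
    simp only [Derivation.map_smul, map_smul, RingHom.id_apply]
    rw [smul_finsum' c (finite_support_shift_pd a)]

theorem varDerDensity_shift (L : ℤ × ℤ) (a : A) :
    varDerDensity (shift L a) = varDerDensity a := by
  change ∑ᶠ N : ℤ × ℤ, shift (-N) (pd N (shift L a)) = ∑ᶠ N : ℤ × ℤ, shift (-N) (pd N a)
  rw [← finsum_comp_equiv (Equiv.subRight L) (f := fun N => shift (-N) (pd N a))]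
  refine finsum_congr fun N => ?_
  rw [pd_shift', ← shift_add, Equiv.subRight_apply]
  congr 2
  abel

theorem totalDifferences_le_ker : totalDifferences A ≤ LinearMap.ker (varDerDensity (A := A)) := by
  refine sup_le ?_ ?_ <;>
  · rintro _ ⟨a, rfl⟩
    simp only [LinearMap.mem_ker, LinearMap.sub_apply, map_sub, LinearMap.id_apply, sub_eq_zero]
    exact varDerDensity_shift _ a

/-- The variational derivative `δF/δu` of a local functional `F`. -/
def varDer : LocalFunctional A →ₗ[ℂ] A :=
  (totalDifferences A).liftQ varDerDensity totalDifferences_le_ker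

/-! ## Difference operators -/

/-- `ℤ²` acts on `A` by shifts. -/
instance instMulSemiringAction : MulSemiringAction (Multiplicative (ℤ × ℤ)) A :=
  MulSemiringAction.compHom A (shiftHom (A := A))

variable (A) in
/-- Scalar local difference operators `∑_L P_L 𝓢^L`, with the product determined by
`𝓢^L ∘ a = 𝓢^L(a) 𝓢^L`. -/
abbrev DiffOp : Type _ := SkewMonoidAlgebra A (Multiplicative (ℤ × ℤ))

variable (A) in
/-- `𝓢^L` as a difference operator. -/
def opShift (L : ℤ × ℤ) : DiffOp A := SkewMonoidAlgebra.single (Multiplicative.ofAdd L) 1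

/-- Multiplication by `a` as a difference operator. -/
def opFun (a : A) : DiffOp A := SkewMonoidAlgebra.single 1 a

theorem opShift_mul_opFun (L : ℤ × ℤ) (a : A) :
    opShift A L * opFun a = opFun (shift L a) * opShift A L := by
  simp only [opShift, opFun, SkewMonoidAlgebra.single_mul_single, one_mul, mul_one, smul_one]
  rfl

/-- The value `P(a) = ∑_L P_L 𝓢^L(a)`. -/
def opApply (P : DiffOp A) (a : A) : A :=
  P.sum fun L p => p * shift (Multiplicative.toAdd L) a

/-- The evolutionary vector field `∑_N 𝓢^N(q) ∂/∂u_N` with characteristic `q`, applied to `a`. -/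
def evolutionary (q a : A) : A := ∑ᶠ N : ℤ × ℤ, shift N q * pd N a

/-- The evolutionary vector field `X_F`, with characteristic `P(δF/δu)`. -/
def hamVectorField (P : DiffOp A) (F : LocalFunctional A) (a : A) : A :=
  evolutionary (opApply P (varDer F)) a

/-- The bracket `{F, G} = ∫ (δG/δu) P(δF/δu)` on local functionals. -/
def poissonBracket (P : DiffOp A) (F G : LocalFunctional A) : LocalFunctional A :=
  integral (varDer G * opApply P (varDer F))

/-- `P` is a Hamiltonian operator: its bracket is a Lie bracket on local functionals (bilinearity
is clear), and `F ↦ X_F` is a morphism to the Lie algebra of evolutionary vector fields. -/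
structure IsHamiltonian (P : DiffOp A) : Prop where
  skew : ∀ F G : LocalFunctional A, poissonBracket P F G = -poissonBracket P G F
  jacobi : ∀ F G H : LocalFunctional A,
    poissonBracket P F (poissonBracket P G H) - poissonBracket P G (poissonBracket P F H) =
      poissonBracket P (poissonBracket P F G) H
  morphism : ∀ (F G : LocalFunctional A) (a : A),
    hamVectorField P (poissonBracket P F G) a =
      hamVectorField P F (hamVectorField P G a) - hamVectorField P G (hamVectorField P F a)

/-- The skew-adjoint operator `f 𝓢₁ + g 𝓢₂ - 𝓢₂⁻¹ ∘ g - 𝓢₁⁻¹ ∘ f`. -/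
def firstOrderOp (f g : A) : DiffOp A :=
  opFun f * opShift A (1, 0) + opFun g * opShift A (0, 1)
    - opShift A (0, -1) * opFun g - opShift A (-1, 0) * opFun f

/-- The operator `φ (α 𝓢₁ + β 𝓢₂ - β 𝓢₂⁻¹ - α 𝓢₁⁻¹) ∘ φ` with constants `α`, `β`. -/
def normalFormOp (α β : ℂ) (φ : A) : DiffOp A :=
  opFun φ *
    (opFun (algebraMap ℂ A α) * opShift A (1, 0) + opFun (algebraMap ℂ A β) * opShift A (0, 1)
      - opFun (algebraMap ℂ A β) * opShift A (0, -1)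
      - opFun (algebraMap ℂ A α) * opShift A (-1, 0)) *
    opFun φ

/-- `a` is a function of the single variable `u = u_{(0,0)}`. -/
def IsFunctionOfGen (a : A) : Prop := ∀ N : ℤ × ℤ, N ≠ 0 → pd N a = 0

end General

/-- `ι` embeds the algebra of difference functions `A` in `B`, compatibly with the generator, the
shifts and the partial derivatives. -/
structure IsEmbedding {A B : Type*} [CommRing A] [Algebra ℂ A] [DifferenceAlgebra A]
    [CommRing B] [Algebra ℂ B] [DifferenceAlgebra B] (ι : A →ₐ[ℂ] B) : Prop where
  injective : Function.Injective ι
  map_gen : ι gen = gen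
  map_shift : ∀ (N : ℤ × ℤ) (a : A), ι (shift N a) = shift N (ι a)
  map_pd : ∀ (N : ℤ × ℤ) (a : A), ι (pd N a) = pd N (ι a)

/-! ## Extension of a derivation to the ring of fractions -/

section Fractions

variable {R : Type*} [CommRing R] [Algebra ℂ R]

/-- `x ↦ x + ε D x`. -/
def dualHom (D : Derivation ℂ R R) :
    R →+* TrivSqZeroExt (FractionRing R) (FractionRing R) where
  toFun x := (algebraMap R (FractionRing R) x, algebraMap R (FractionRing R) (D x))
  map_zero' := by
    refine TrivSqZeroExt.ext (map_zero _) ?_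
    change algebraMap R (FractionRing R) (D 0) = 0
    rw [map_zero, map_zero]
  map_one' := by
    refine TrivSqZeroExt.ext (map_one _) ?_
    change algebraMap R (FractionRing R) (D 1) = 0
    rw [Derivation.map_one_eq_zero, map_zero]
  map_add' x y := by
    refine TrivSqZeroExt.ext (map_add _ x y) ?_
    change algebraMap R (FractionRing R) (D (x + y)) = _
    rw [map_add, map_add]
    rfl
  map_mul' x y := by
    refine TrivSqZeroExt.ext (map_mul _ x y) ?_
    change algebraMap R (FractionRing R) (D (x * y)) =
      algebraMap R (FractionRing R) x * algebraMap R (FractionRing R) (D y) +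
        algebraMap R (FractionRing R) (D x) * algebraMap R (FractionRing R) y
    rw [Derivation.leibniz, smul_eq_mul, smul_eq_mul, map_add, map_mul, map_mul,
      mul_comm (algebraMap R _ y)]

theorem fst_dualHom (D : Derivation ℂ R R) (x : R) :
    (dualHom D x).fst = algebraMap R (FractionRing R) x := rfl

theorem snd_dualHom (D : Derivation ℂ R R) (x : R) :
    (dualHom D x).snd = algebraMap R (FractionRing R) (D x) := rfl

theorem dualHom_isUnit (D : Derivation ℂ R R) (y : nonZeroDivisors R) :
    IsUnit (dualHom D (y : R)) := by
  rw [TrivSqZeroExt.isUnit_iff_isUnit_fst]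
  exact IsLocalization.map_units (FractionRing R) y

/-- The extension of `dualHom` to the ring of fractions. -/
def dualHomFrac (D : Derivation ℂ R R) :
    FractionRing R →+* TrivSqZeroExt (FractionRing R) (FractionRing R) :=
  IsLocalization.lift (M := nonZeroDivisors R) (dualHom_isUnit D)

theorem dualHomFrac_algebraMap (D : Derivation ℂ R R) (x : R) :
    dualHomFrac D (algebraMap R (FractionRing R) x) = dualHom D x :=
  IsLocalization.lift_eq (dualHom_isUnit D) x

theorem fst_dualHomFrac (D : Derivation ℂ R R) (x : FractionRing R) :
    (dualHomFrac D x).fst = x := by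
  have h : (TrivSqZeroExt.fstHom ℂ (FractionRing R) (FractionRing R)).toRingHom.comp
      (dualHomFrac D) = RingHom.id _ := by
    refine IsLocalization.ringHom_ext (nonZeroDivisors R) ?_
    ext x
    simp [dualHomFrac_algebraMap, fst_dualHom]
  exact congrArg (fun g : FractionRing R →+* FractionRing R => g x) h

/-- The extension of a derivation to the ring of fractions (by the quotient rule). -/
def derivFrac (D : Derivation ℂ R R) : Derivation ℂ (FractionRing R) (FractionRing R) :=
  Derivation.mk'
    { toFun := fun x => (dualHomFrac D x).snd
      map_add' := fun x y => by simp
      map_smul' := fun c x => by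
        rw [Algebra.smul_def, IsScalarTower.algebraMap_apply ℂ R (FractionRing R), map_mul,
          dualHomFrac_algebraMap]
        simp [fst_dualHom, snd_dualHom, fst_dualHomFrac, Algebra.smul_def,
          IsScalarTower.algebraMap_apply ℂ R (FractionRing R)] }
    (fun x y => by simp [fst_dualHomFrac, mul_comm])

theorem derivFrac_algebraMap (D : Derivation ℂ R R) (x : R) :
    derivFrac D (algebraMap R (FractionRing R) x) = algebraMap R (FractionRing R) (D x) := by
  change (dualHomFrac D (algebraMap R (FractionRing R) x)).snd = _
  rw [dualHomFrac_algebraMap, snd_dualHom]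

/-- A derivation on the ring of fractions vanishes on a fraction if it vanishes on the numerator
and on the denominator. -/
theorem deriv_mk'_eq_zero (D : Derivation ℂ (FractionRing R) (FractionRing R)) (a : R)
    (b : nonZeroDivisors R) (ha : D (algebraMap R (FractionRing R) a) = 0)
    (hb : D (algebraMap R (FractionRing R) b) = 0) :
    D (IsLocalization.mk' (FractionRing R) a b) = 0 := by
  have h := IsLocalization.mk'_spec (FractionRing R) a b
  have h2 := congrArg D h
  rw [Derivation.leibniz, ha, hb, smul_zero, zero_add, smul_eq_mul] at h2
  exact (IsLocalization.map_units (FractionRing R) b).mul_right_eq_zero.mp h2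

theorem deriv_frac_ext {D₁ D₂ : Derivation ℂ (FractionRing R) (FractionRing R)}
    (h : ∀ a : R, D₁ (algebraMap R (FractionRing R) a) = D₂ (algebraMap R (FractionRing R) a)) :
    D₁ = D₂ := by
  ext x
  obtain ⟨a, b, rfl⟩ := IsLocalization.exists_mk'_eq (nonZeroDivisors R) x
  rw [← sub_eq_zero, ← Derivation.sub_apply]
  apply deriv_mk'_eq_zero <;> simp [h]

/-- The extension of an automorphism to the ring of fractions. -/
def autFrac (e : R ≃ₐ[ℂ] R) : FractionRing R ≃ₐ[ℂ] FractionRing R :=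
  IsLocalization.algEquivOfAlgEquiv (FractionRing R) (FractionRing R) e
    (MulEquivClass.map_nonZeroDivisors e)

theorem autFrac_algebraMap (e : R ≃ₐ[ℂ] R) (x : R) :
    autFrac e (algebraMap R (FractionRing R) x) = algebraMap R (FractionRing R) (e x) :=
  IsLocalization.algEquivOfAlgEquiv_eq _ x

theorem algEquiv_frac_ext {e₁ e₂ : FractionRing R ≃ₐ[ℂ] FractionRing R}
    (h : ∀ a : R, e₁ (algebraMap R (FractionRing R) a) = e₂ (algebraMap R (FractionRing R) a)) :
    e₁ = e₂ := by
  have : (e₁ : FractionRing R →+* FractionRing R) = e₂ :=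
    IsLocalization.ringHom_ext (nonZeroDivisors R) (RingHom.ext h)
  ext x
  exact congrArg (fun g : FractionRing R →+* FractionRing R => g x) this

/-- `autFrac` as a homomorphism of groups. -/
def autFracHom : (R ≃ₐ[ℂ] R) →* (FractionRing R ≃ₐ[ℂ] FractionRing R) where
  toFun := autFrac
  map_one' := algEquiv_frac_ext fun a => by simp [autFrac_algebraMap]
  map_mul' e₁ e₂ := algEquiv_frac_ext fun a => by simp [autFrac_algebraMap]

/-- The ring of fractions of an algebra of difference functions. -/
instance instFractionRing [DifferenceAlgebra R] : DifferenceAlgebra (FractionRing R) where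
  shiftHom := autFracHom.comp shiftHom
  gen := algebraMap R (FractionRing R) gen
  pd N := derivFrac (pd N)
  algebraicIndependent := by
    have h := (algebraicIndependent (A := R)).map'
      (f := IsScalarTower.toAlgHom ℂ R (FractionRing R)) (IsFractionRing.injective R _)
    convert h using 1
    ext N
    exact autFrac_algebraMap _ _
  pd_gen M N := by
    change derivFrac (pd M) (autFrac _ (algebraMap R _ gen)) = _
    rw [autFrac_algebraMap, derivFrac_algebraMap, pd_gen]
    split_ifs <;> simp
  pd_comm M N a := by
    have : ⁅derivFrac (R := R) (pd M), derivFrac (pd N)⁆ = 0 :=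
      deriv_frac_ext (R := R) fun b => by
        rw [Derivation.commutator_apply, derivFrac_algebraMap, derivFrac_algebraMap,
          derivFrac_algebraMap, derivFrac_algebraMap, pd_comm M N b, sub_self,
          Derivation.zero_apply]
    have h2 := congrArg (fun D : Derivation ℂ (FractionRing R) (FractionRing R) => D a) this
    simpa [Derivation.commutator_apply, sub_eq_zero] using h2
  pd_finite x := by
    obtain ⟨a, b, rfl⟩ := IsLocalization.exists_mk'_eq (nonZeroDivisors R) x
    refine ((pd_finite a).union (pd_finite (b : R))).subset fun N hN => ?_
    by_contra hc
    simp only [Set.mem_union, Set.mem_ofPred_eq, not_or, not_not] at hc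
    apply hN
    apply deriv_mk'_eq_zero <;> rw [derivFrac_algebraMap] <;> simp [hc.1, hc.2]
  pd_shift M N x := by
    change derivFrac (pd M) (autFrac _ x) = autFrac _ (derivFrac (pd (M - N)) x)
    set e : R ≃ₐ[ℂ] R := shiftHom (Multiplicative.ofAdd N)
    obtain ⟨a, b, rfl⟩ := IsLocalization.exists_mk'_eq (nonZeroDivisors R) x
    have key : ∀ a : R, derivFrac (pd M) (autFrac e (algebraMap R (FractionRing R) a)) =
        autFrac e (derivFrac (pd (M - N)) (algebraMap R (FractionRing R) a)) := fun a => by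
      rw [autFrac_algebraMap, derivFrac_algebraMap, derivFrac_algebraMap, autFrac_algebraMap,
        pd_shift]
    set y := IsLocalization.mk' (FractionRing R) a b
    have hspec : y * algebraMap R (FractionRing R) b = algebraMap R (FractionRing R) a :=
      IsLocalization.mk'_spec (FractionRing R) a b
    have h1 := key a
    rw [← hspec, map_mul, Derivation.leibniz, Derivation.leibniz, map_add, smul_eq_mul,
      smul_eq_mul, smul_eq_mul, smul_eq_mul, map_mul, map_mul, key b, add_right_inj] at h1
    exact ((IsLocalization.map_units (FractionRing R) b).map (autFrac e)).mul_left_cancel h1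

end Fractions

end DifferenceAlgebra

/-! ## Meromorphic difference functions -/

open DifferenceAlgebra

section Holomorphic

open TopologicalSpace (Opens)

variable (U : Opens ℂ)

/-- `F`, a function of variables `u_N ∈ U`, `N ∈ ℤ²`, is a holomorphic function of the finitely many
variables `u_N`, `N ∈ s`. -/
def IsHolomorphicIn (s : Finset (ℤ × ℤ)) (F : (ℤ × ℤ → U) → ℂ) : Prop :=
  ∃ G : (s → ℂ) → ℂ, AnalyticOnNhd ℂ G {y | ∀ i, y i ∈ U} ∧ ∀ x, F x = G fun i => x i

variable {U}

theorem IsHolomorphicIn.mono {s t : Finset (ℤ × ℤ)} (hst : s ⊆ t) {F : (ℤ × ℤ → U) → ℂ}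
    (hF : IsHolomorphicIn U s F) : IsHolomorphicIn U t F := by
  obtain ⟨G, hG, hGF⟩ := hF
  let r : (t → ℂ) →L[ℂ] (s → ℂ) :=
    ContinuousLinearMap.pi fun i => ContinuousLinearMap.proj (⟨i, hst i.2⟩ : t)
  refine ⟨fun y => G (r y), fun y hy => ?_, fun x => ?_⟩
  · have h1 : AnalyticAt ℂ G (r y) := hG _ fun i => hy _
    exact h1.comp (r.analyticAt y)
  · rw [hGF]; rfl

variable (U) in
/-- The algebra of holomorphic functions of finitely many of the variables `u_N ∈ U`. -/
def HolomorphicFunctions : Subalgebra ℂ ((ℤ × ℤ → U) → ℂ) where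
  carrier := {F | ∃ s, IsHolomorphicIn U s F}
  mul_mem' := by
    rintro F F' ⟨s, h⟩ ⟨t, h'⟩
    classical
    obtain ⟨G, hG, hF⟩ := h.mono (t := s ∪ t) Finset.subset_union_left
    obtain ⟨G', hG', hF'⟩ := h'.mono (t := s ∪ t) Finset.subset_union_right
    exact ⟨s ∪ t, G * G', hG.mul hG', fun x => by simp [hF, hF']⟩
  add_mem' := by
    rintro F F' ⟨s, h⟩ ⟨t, h'⟩
    classical
    obtain ⟨G, hG, hF⟩ := h.mono (t := s ∪ t) Finset.subset_union_left
    obtain ⟨G', hG', hF'⟩ := h'.mono (t := s ∪ t) Finset.subset_union_right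
    exact ⟨s ∪ t, G + G', hG.add hG', fun x => by simp [hF, hF']⟩
  algebraMap_mem' c := ⟨∅, fun _ => c, analyticOnNhd_const, fun x => rfl⟩

open Classical in
/-- `F` as a function of `u_N = z` alone, the other variables being frozen at `x`. -/
def slice (F : (ℤ × ℤ → U) → ℂ) (x : ℤ × ℤ → U) (N : ℤ × ℤ) (z : ℂ) : ℂ :=
  if h : z ∈ U then F (Function.update x N ⟨z, h⟩) else 0

/-- The partial derivative `∂F/∂u_N`. -/
def partialDeriv (N : ℤ × ℤ) (F : (ℤ × ℤ → U) → ℂ) (x : ℤ × ℤ → U) : ℂ :=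
  deriv (slice F x N) (x N)

theorem hasDerivAt_slice {s : Finset (ℤ × ℤ)} {N : ℤ × ℤ} (hN : N ∈ s) {F : (ℤ × ℤ → U) → ℂ}
    {G : (s → ℂ) → ℂ} (hG : AnalyticOnNhd ℂ G {y | ∀ i, y i ∈ U})
    (hF : ∀ x, F x = G fun i => x i) (x : ℤ × ℤ → U) :
    HasDerivAt (slice F x N) (fderiv ℂ G (fun i => x i) (Pi.single ⟨N, hN⟩ 1)) (x N) := by
  classical
  have h1 : HasFDerivAt G (fderiv ℂ G (fun i : s => (x i : ℂ))) (fun i : s => (x i : ℂ)) :=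
    (hG _ fun i => (x i).2).differentiableAt.hasFDerivAt
  have h2 := hasDerivAt_update (𝕜 := ℂ) (fun i : s => (x i : ℂ)) ⟨N, hN⟩ (x N)
  have h3 : Function.update (fun i : s => (x i : ℂ)) ⟨N, hN⟩ (x N : ℂ) = fun i : s => (x i : ℂ) :=
    Function.update_eq_self (⟨N, hN⟩ : s) (fun i : s => (x i : ℂ))
  have h4 := HasFDerivAt.comp_hasDerivAt_of_eq (x N : ℂ) h1 h2 h3.symm
  refine h4.congr_of_eventuallyEq ?_
  filter_upwards [U.isOpen.mem_nhds (x N).2] with z hz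
  have hz' : z ∈ U := hz
  simp only [slice, hz', dif_pos, hF, Function.comp]
  congr 1
  ext i
  by_cases hi : i = ⟨N, hN⟩
  · subst hi; simp
  · have : (i : ℤ × ℤ) ≠ N := fun h => hi (Subtype.ext h)
    simp [hi, this]

theorem partialDeriv_eq {s : Finset (ℤ × ℤ)} {N : ℤ × ℤ} (hN : N ∈ s) {F : (ℤ × ℤ → U) → ℂ}
    {G : (s → ℂ) → ℂ} (hG : AnalyticOnNhd ℂ G {y | ∀ i, y i ∈ U})
    (hF : ∀ x, F x = G fun i => x i) (x : ℤ × ℤ → U) :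
    partialDeriv N F x = fderiv ℂ G (fun i => x i) (Pi.single ⟨N, hN⟩ 1) :=
  (hasDerivAt_slice hN hG hF x).deriv

theorem analyticOnNhd_partial {s : Finset (ℤ × ℤ)} {G : (s → ℂ) → ℂ}
    (hG : AnalyticOnNhd ℂ G {y | ∀ i, y i ∈ U}) (v : s → ℂ) :
    AnalyticOnNhd ℂ (fun y => fderiv ℂ G y v) {y | ∀ i, y i ∈ U} := fun y hy =>
  ((ContinuousLinearMap.apply ℂ ℂ v).analyticAt _).comp (hG.fderiv y hy)

theorem partialDeriv_mem (N : ℤ × ℤ) {F : (ℤ × ℤ → U) → ℂ} (hF : F ∈ HolomorphicFunctions U) :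
    partialDeriv N F ∈ HolomorphicFunctions U := by
  classical
  obtain ⟨s, h⟩ := hF
  obtain ⟨G, hG, hGF⟩ := h.mono (Finset.subset_insert N s)
  exact ⟨insert N s, _, analyticOnNhd_partial hG (Pi.single ⟨N, Finset.mem_insert_self N s⟩ 1),
    fun x => partialDeriv_eq _ hG hGF x⟩

theorem differentiableAt_slice (N : ℤ × ℤ) {F : (ℤ × ℤ → U) → ℂ} (hF : F ∈ HolomorphicFunctions U)
    (x : ℤ × ℤ → U) : DifferentiableAt ℂ (slice F x N) (x N) := by
  classical
  obtain ⟨s, h⟩ := hF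
  obtain ⟨G, hG, hGF⟩ := h.mono (Finset.subset_insert N s)
  exact (hasDerivAt_slice (Finset.mem_insert_self N s) hG hGF x).differentiableAt

theorem slice_self (F : (ℤ × ℤ → U) → ℂ) (x : ℤ × ℤ → U) (N : ℤ × ℤ) :
    slice F x N (x N) = F x := by
  simp [slice]

theorem slice_add (F F' : (ℤ × ℤ → U) → ℂ) (x : ℤ × ℤ → U) (N : ℤ × ℤ) :
    slice (F + F') x N = slice F x N + slice F' x N := by
  ext z; by_cases h : z ∈ U <;> simp [slice, h]

theorem slice_mul (F F' : (ℤ × ℤ → U) → ℂ) (x : ℤ × ℤ → U) (N : ℤ × ℤ) :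
    slice (F * F') x N = slice F x N * slice F' x N := by
  ext z; by_cases h : z ∈ U <;> simp [slice, h]

theorem slice_smul (c : ℂ) (F : (ℤ × ℤ → U) → ℂ) (x : ℤ × ℤ → U) (N : ℤ × ℤ) :
    slice (c • F) x N = c • slice F x N := by
  ext z; by_cases h : z ∈ U <;> simp [slice, h]

variable (U) in
/-- `∂/∂u_N` as a derivation. -/
def holoPd (N : ℤ × ℤ) : Derivation ℂ (HolomorphicFunctions U) (HolomorphicFunctions U) :=
  Derivation.mk'
    { toFun := fun F => ⟨partialDeriv N F, partialDeriv_mem N F.2⟩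
      map_add' := fun F F' => by
        ext x
        change deriv (slice ((F : (ℤ × ℤ → U) → ℂ) + (F' : (ℤ × ℤ → U) → ℂ)) x N) (x N) = _
        rw [slice_add, deriv_add (differentiableAt_slice N F.2 x) (differentiableAt_slice N F'.2 x)]
        rfl
      map_smul' := fun c F => by
        ext x
        change deriv (slice (c • (F : (ℤ × ℤ → U) → ℂ)) x N) (x N) = _
        rw [slice_smul, deriv_const_smul c (differentiableAt_slice N F.2 x)]
        rfl }
    (fun F F' => by
      ext x
      change deriv (slice ((F : (ℤ × ℤ → U) → ℂ) * (F' : (ℤ × ℤ → U) → ℂ)) x N) (x N) = _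
      rw [slice_mul, deriv_mul (differentiableAt_slice N F.2 x) (differentiableAt_slice N F'.2 x),
        slice_self, slice_self, mul_comm, add_comm]
      rfl)

theorem holoPd_apply (N : ℤ × ℤ) (F : HolomorphicFunctions U) (x : ℤ × ℤ → U) :
    (holoPd U N F : (ℤ × ℤ → U) → ℂ) x = partialDeriv N F x := rfl

/-- `(𝓢^K F)(u) = F(𝓢^K u)` with `(𝓢^K u)_N = u_{N+K}`. -/
def shiftFun (K : ℤ × ℤ) (F : (ℤ × ℤ → U) → ℂ) (x : ℤ × ℤ → U) : ℂ := F fun N => x (N + K)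

theorem shiftFun_mem (K : ℤ × ℤ) {F : (ℤ × ℤ → U) → ℂ} (hF : F ∈ HolomorphicFunctions U) :
    shiftFun K F ∈ HolomorphicFunctions U := by
  classical
  obtain ⟨s, G, hG, hGF⟩ := hF
  let r : ((s.image (· + K) : Finset (ℤ × ℤ)) → ℂ) →L[ℂ] (s → ℂ) :=
    ContinuousLinearMap.pi fun i =>
      ContinuousLinearMap.proj (⟨i + K, Finset.mem_image_of_mem _ i.2⟩ : (s.image (· + K) : Finset _))
  refine ⟨s.image (· + K), fun y => G (r y), fun y hy => ?_, fun x => ?_⟩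
  · have h1 : AnalyticAt ℂ G (r y) := hG _ fun i => hy _
    exact h1.comp (r.analyticAt y)
  · rw [shiftFun, hGF]; rfl

variable (U) in
/-- The shifts as automorphisms of the algebra of holomorphic functions. -/
def holoShift (K : ℤ × ℤ) : HolomorphicFunctions U ≃ₐ[ℂ] HolomorphicFunctions U :=
  AlgEquiv.ofAlgHom
    { toFun := fun F => ⟨shiftFun K F, shiftFun_mem K F.2⟩
      map_one' := rfl, map_mul' := fun _ _ => rfl, map_zero' := rfl, map_add' := fun _ _ => rfl
      commutes' := fun _ => rfl }
    { toFun := fun F => ⟨shiftFun (-K) F, shiftFun_mem (-K) F.2⟩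
      map_one' := rfl, map_mul' := fun _ _ => rfl, map_zero' := rfl, map_add' := fun _ _ => rfl
      commutes' := fun _ => rfl }
    (by
      ext F x
      change (F : (ℤ × ℤ → U) → ℂ) (fun N => x (N + -K + K)) = (F : (ℤ × ℤ → U) → ℂ) x
      simp)
    (by
      ext F x
      change (F : (ℤ × ℤ → U) → ℂ) (fun N => x (N + K + -K)) = (F : (ℤ × ℤ → U) → ℂ) x
      simp)

theorem holoShift_apply (K : ℤ × ℤ) (F : HolomorphicFunctions U) (x : ℤ × ℤ → U) :
    (holoShift U K F : (ℤ × ℤ → U) → ℂ) x = (F : (ℤ × ℤ → U) → ℂ) fun N => x (N + K) := rfl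

variable (U) in
/-- The coordinate function `u = u_{(0,0)}`. -/
def holoGen : HolomorphicFunctions U :=
  ⟨fun x => x 0, {0}, fun y => y ⟨0, by simp⟩,
    (ContinuousLinearMap.proj (R := ℂ) (φ := fun _ : ({0} : Finset (ℤ × ℤ)) => ℂ)
      (⟨0, by simp⟩ : ({0} : Finset (ℤ × ℤ)))).analyticOnNhd _, fun _ => rfl⟩

theorem holoShift_gen (N : ℤ × ℤ) (x : ℤ × ℤ → U) :
    (holoShift U N (holoGen U) : (ℤ × ℤ → U) → ℂ) x = x N := by
  change ((x (0 + N) : U) : ℂ) = x N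
  rw [zero_add]

theorem infinite_of_nonempty [Nonempty U] : (U : Set ℂ).Infinite := by
  obtain ⟨z⟩ := ‹Nonempty U›
  exact infinite_of_mem_nhds (z : ℂ) (U.isOpen.mem_nhds z.2)

instance instHolomorphicFunctions [Nonempty U] : DifferenceAlgebra (HolomorphicFunctions U) where
  shiftHom :=
    { toFun := fun K => holoShift U (Multiplicative.toAdd K)
      map_one' := by ext F x; simp [holoShift_apply]
      map_mul' := fun K L => by
        ext F x
        simp only [AlgEquiv.mul_apply, holoShift_apply, toAdd_mul]
        refine congrArg (F : (ℤ × ℤ → U) → ℂ) (funext fun N => ?_)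
        rw [add_assoc, add_comm (Multiplicative.toAdd L)] }
  gen := holoGen U
  pd := holoPd U
  algebraicIndependent := by
    rw [algebraicIndependent_iff]
    intro p hp
    refine MvPolynomial.funext_set (fun _ => (U : Set ℂ)) (fun _ => infinite_of_nonempty)
      fun x hx => ?_
    let y : ℤ × ℤ → U := fun N => ⟨x N, hx N trivial⟩
    let ev : HolomorphicFunctions U →ₐ[ℂ] ℂ :=
      (Pi.evalAlgHom ℂ (fun _ : ℤ × ℤ → U => ℂ) y).comp (HolomorphicFunctions U).val
    have h := congrArg ev hp
    rw [MvPolynomial.comp_aeval_apply, map_zero] at h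
    have h2 : (fun N : ℤ × ℤ => ev (holoShift U N (holoGen U))) = x :=
      funext fun N => holoShift_gen N y
    change MvPolynomial.aeval (fun N : ℤ × ℤ => ev (holoShift U N (holoGen U))) p = 0 at h
    rw [h2] at h
    simpa [MvPolynomial.aeval_eq_eval] using h
  pd_gen M N := by
    ext x
    change deriv (slice (fun x => (holoShift U N (holoGen U) : (ℤ × ℤ → U) → ℂ) x) x M) (x M) = _
    simp only [holoShift_gen]
    by_cases h : M = N
    · subst h
      have : slice (fun x : ℤ × ℤ → U => (x M : ℂ)) x M =ᶠ[𝓝 (x M : ℂ)] id := by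
        filter_upwards [U.isOpen.mem_nhds (x M).2] with z hz
        have hz' : z ∈ U := hz
        simp [slice, hz']
      rw [this.deriv_eq]
      simp
    · have : slice (fun x : ℤ × ℤ → U => (x N : ℂ)) x M =ᶠ[𝓝 (x M : ℂ)] fun _ => (x N : ℂ) := by
        filter_upwards [U.isOpen.mem_nhds (x M).2] with z hz
        have hz' : z ∈ U := hz
        simp [slice, hz', Function.update_of_ne (Ne.symm h)]
      rw [this.deriv_eq]
      simp [h]
  pd_comm M N F := by
    classical
    obtain ⟨s, hs⟩ := F.2
    obtain ⟨G, hG, hGF⟩ := hs.mono (t := insert M (insert N s))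
      ((Finset.subset_insert _ _).trans (Finset.subset_insert _ _))
    have hM : M ∈ insert M (insert N s) := by simp
    have hN : N ∈ insert M (insert N s) := by simp
    ext x
    change partialDeriv M (partialDeriv N (F : (ℤ × ℤ → U) → ℂ)) x =
      partialDeriv N (partialDeriv M (F : (ℤ × ℤ → U) → ℂ)) x
    rw [partialDeriv_eq hM (analyticOnNhd_partial hG _) (fun x => partialDeriv_eq hN hG hGF x),
      partialDeriv_eq hN (analyticOnNhd_partial hG _) (fun x => partialDeriv_eq hM hG hGF x)]
    have hx : (fun i => (x i : ℂ) : (insert M (insert N s) : Finset (ℤ × ℤ)) → ℂ) ∈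
        {y : (insert M (insert N s) : Finset (ℤ × ℤ)) → ℂ | ∀ i, y i ∈ U} := fun i => (x i).2
    have hd : DifferentiableAt ℂ (fderiv ℂ G)
        (fun i : (insert M (insert N s) : Finset (ℤ × ℤ)) => (x i : ℂ)) :=
      (hG.fderiv _ hx).differentiableAt
    have hsymm := ((hG _ hx).contDiffAt (n := ⊤)).isSymmSndFDerivAt_of_omega
    rw [fderiv_clm_apply hd (differentiableAt_const _),
      fderiv_clm_apply hd (differentiableAt_const _)]
    simpa using hsymm _ _
  pd_finite F := by
    obtain ⟨s, G, hG, hGF⟩ := F.2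
    refine s.finite_toSet.subset fun N hN => ?_
    by_contra hc
    apply hN
    ext x
    change deriv (slice (F : (ℤ × ℤ → U) → ℂ) x N) (x N) = 0
    have : slice (F : (ℤ × ℤ → U) → ℂ) x N =ᶠ[𝓝 (x N : ℂ)] fun _ => (F : (ℤ × ℤ → U) → ℂ) x := by
      filter_upwards [U.isOpen.mem_nhds (x N).2] with z hz
      have hz' : z ∈ U := hz
      simp only [slice, hz', dif_pos, hGF]
      congr 1
      ext i
      have : (i : ℤ × ℤ) ≠ N := fun h => hc (h ▸ i.2)
      simp [this]
    rw [this.deriv_eq]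
    simp
  pd_shift M N F := by
    ext x
    change deriv (slice (shiftFun N (F : (ℤ × ℤ → U) → ℂ)) x M) (x M) =
      deriv (slice (F : (ℤ × ℤ → U) → ℂ) (fun K => x (K + N)) (M - N)) (x (M - N + N))
    rw [sub_add_cancel]
    congr 1
    funext z
    by_cases h : z ∈ U
    · simp only [slice, h, dif_pos, shiftFun]
      refine congrArg (F : (ℤ × ℤ → U) → ℂ) (funext fun K => ?_)
      by_cases hK : K = M - N
      · subst hK; simp
      · have : K + N ≠ M := fun h => hK (eq_sub_of_add_eq h)
        simp [hK, this]
    · simp [slice, h]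

variable (U) in
/-- Meromorphic difference functions: fractions of holomorphic functions of finitely many of the
variables `u_N ∈ U`, `N ∈ ℤ²`. -/
abbrev MeromorphicFunctions : Type := FractionRing (HolomorphicFunctions U)

end Holomorphic

end

open DifferenceAlgebra

noncomputable section

namespace DifferenceAlgebra

section Calculus

variable {A : Type*} [CommRing A] [Algebra ℂ A] [DifferenceAlgebra A]

/-! ## Shifts and evolutionary vector fields -/

/-! An evolutionary field is determined by its value on `gen`, and a commutator of such fields is
evolutionary, so for `a = δF/δu`, `b = δG/δu` the morphism property is one equation between
characteristics. In it `δ/δu ∫ b P(a)` is expanded by the Leibniz rule. Since the linearizations of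
`a` and `b` are self-adjoint and `P` is skew-adjoint, all derivatives of `a` and `b` cancel, and
there remains an identity bilinear in the shifts of `a` and `b`, involving only the coefficients of
`P` and their derivatives (`isHamiltonian_iff`). Skew-symmetry and the Jacobi identity on
functionals come along for free.

Necessity. Every power `u^k` is a variational derivative and the `u_N` are distinct elements of a
domain, so a Vandermonde argument kills each coefficient of the bilinear identity. These
coefficients are the Jacobiators of the lattice bracket `{u_X, u_Y} = 𝓢^X p(Y - X)`, in which only
nearest neighbours interact (`siteBracket_jacobi`). Bracketing `f` with a site just beyond one of
its extremal variables shows that `f` depends only on `u_{(0,0)}` and `u_{(1,0)}`; likewise `g`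
depends only on `u_{(0,0)}` and `u_{(0,1)}` (`pd_coeff`). The Jacobi identity on bent or straight
paths of length two through the origin then shows that, when `f ≠ 0`, each of `x = f, 𝓢₁⁻¹f, g,
𝓢₂⁻¹g` satisfies `∂x/∂u = ψ x` with one common `ψ` (`proportional`). As `f` does not involve
`u_{(-1,0)}` and `𝓢₁⁻¹f` does not involve `u_{(1,0)}`, this `ψ` is a function of `u` alone. Freezing
all variables of `f` except `u` at a generic point solves `φ' = ψφ` by a meromorphic `φ(u)`, with no
integration needed (`exists_isFunctionOfGen`). Now `f / (φ 𝓢₁φ)` and `g / (φ 𝓢₂φ)` have vanishing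
partial derivatives, hence are constants because `U` is connected. If `f = 0`, the two lattice
directions exchange roles.

Sufficiency. For `P = φ K ∘ φ` with `K` skew-adjoint with constant coefficients, the bilinear
identity is a direct computation (`opSum_opVar_of_normalForm`), reflecting that the substitution `dv
= du/φ(u)` makes `P` constant. It is checked among meromorphic functions and pulled back along the
injective `ι`, because `φ` need not lie in the given algebra. -/

theorem shift_neg_shift (N : ℤ × ℤ) (a : A) : shift (-N) (shift N a) = a := by
  rw [← shift_add, neg_add_cancel, shift_zero]

theorem shift_shift_neg (N : ℤ × ℤ) (a : A) : shift N (shift (-N) a) = a := by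
  rw [← shift_add, add_neg_cancel, shift_zero]

theorem pd_shift_gen (M N : ℤ × ℤ) :
    pd M (shift N (gen : A)) = if M = N then 1 else 0 := pd_gen M N

theorem pd_zero_gen (M : ℤ × ℤ) : pd M (gen : A) = if M = 0 then 1 else 0 := by
  conv_lhs => rw [← shift_zero (gen : A)]
  exact pd_shift_gen M 0

theorem exists_finset_pd (a : A) : ∃ n : Finset (ℤ × ℤ), ∀ N, N ∉ n → pd N a = 0 :=
  ⟨(pd_finite a).toFinset, fun N hN => by simpa using hN⟩

theorem support_mul_pd_finite (c : ℤ × ℤ → A) (a : A) :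
    (Function.support fun N : ℤ × ℤ => c N * pd N a).Finite :=
  (pd_finite a).subset fun N hN h => hN (by simp [h])

theorem support_shift_mul_pd_finite (c : ℤ × ℤ → A) (a : A) :
    (Function.support fun N : ℤ × ℤ => shift (-N) (c N * pd N a)).Finite :=
  (pd_finite a).subset fun N hN h => hN (by simp [h])

theorem evolutionary_eq_sum {q a : A} {n : Finset (ℤ × ℤ)} (hn : ∀ N, N ∉ n → pd N a = 0) :
    evolutionary q a = ∑ N ∈ n, shift N q * pd N a :=
  finsum_eq_sum_of_support_subset _ fun N hN => by
    by_contra h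
    exact hN (by simp [hn N h])

/-- The evolutionary vector field with characteristic `q`, as a derivation. -/
def evolutionaryDer (q : A) : Derivation ℂ A A :=
  Derivation.mk'
    { toFun := evolutionary q
      map_add' := fun a b => by
        rw [evolutionary, evolutionary, evolutionary,
          ← finsum_add_distrib (support_mul_pd_finite _ a) (support_mul_pd_finite _ b)]
        simp [mul_add]
      map_smul' := fun c a => by
        simp only [evolutionary, RingHom.id_apply]
        rw [smul_finsum' c (support_mul_pd_finite _ a)]
        simp }
    (fun a b => by
      change evolutionary q (a * b) = a * evolutionary q b + b * evolutionary q a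
      rw [evolutionary, evolutionary, evolutionary, mul_finsum' _ _ (support_mul_pd_finite _ b),
        mul_finsum' _ _ (support_mul_pd_finite _ a), ← finsum_add_distrib]
      · refine finsum_congr fun N => ?_
        rw [Derivation.leibniz, smul_eq_mul, smul_eq_mul]
        ring
      · exact (support_mul_pd_finite (fun N => shift N q) b).subset
          fun N hN h => hN (by simp only [h, mul_zero])
      · exact (support_mul_pd_finite (fun N => shift N q) a).subset
          fun N hN h => hN (by simp only [h, mul_zero]))

theorem evolutionaryDer_apply (q a : A) : evolutionaryDer q a = evolutionary q a := rfl

theorem evolutionary_gen (q : A) : evolutionary q gen = q := by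
  rw [evolutionary_eq_sum (n := {0}) fun N hN => by
    rw [pd_zero_gen, if_neg (by simpa using hN)]]
  simp [pd_zero_gen, shift_zero]

theorem evolutionary_shift (q : A) (K : ℤ × ℤ) (a : A) :
    evolutionary q (shift K a) = shift K (evolutionary q a) := by
  obtain ⟨n, hn⟩ := exists_finset_pd a
  rw [evolutionary_eq_sum hn, evolutionary_eq_sum (n := n.map (addRightEmbedding K)), map_sum,
    Finset.sum_map]
  · refine Finset.sum_congr rfl fun N _ => ?_
    rw [addRightEmbedding_apply, pd_shift', add_sub_cancel_right, map_mul, add_comm, shift_add]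
  · intro N hN
    rw [pd_shift', hn, map_zero]
    intro h
    exact hN (Finset.mem_map.2 ⟨_, h, by simp⟩)

theorem evolutionary_sub (q r a : A) :
    evolutionary (q - r) a = evolutionary q a - evolutionary r a := by
  obtain ⟨n, hn⟩ := exists_finset_pd a
  simp only [evolutionary_eq_sum hn, map_sub, sub_mul, Finset.sum_sub_distrib]

/-- The term with second derivatives is isolated because, partial derivatives commuting, it is
symmetric in `q` and `r` and so drops out of the commutator. -/
theorem evolutionary_evolutionary (q r a : A) {n : Finset (ℤ × ℤ)}
    (hn : ∀ N, N ∉ n → pd N a = 0) :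
    evolutionary q (evolutionary r a) = evolutionary (evolutionary q r) a +
      ∑ M ∈ n, ∑ N ∈ n, shift M r * shift N q * pd N (pd M a) := by
  rw [evolutionary_eq_sum (q := r) hn, evolutionary_eq_sum (q := evolutionary q r) hn,
    ← evolutionaryDer_apply, map_sum, ← Finset.sum_add_distrib]
  refine Finset.sum_congr rfl fun M _ => ?_
  rw [Derivation.leibniz, evolutionaryDer_apply, evolutionaryDer_apply, evolutionary_shift,
    evolutionary_eq_sum (a := pd M a) (n := n), smul_eq_mul, smul_eq_mul, Finset.mul_sum, add_comm,
    mul_comm (pd M a)]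
  · simp only [mul_assoc]
  · intro N hN
    rw [pd_comm, hn N hN, map_zero]

/-- The commutator of evolutionary vector fields is evolutionary. -/
theorem evolutionary_commutator (q r a : A) :
    evolutionary q (evolutionary r a) - evolutionary r (evolutionary q a) =
      evolutionary (evolutionary q r - evolutionary r q) a := by
  obtain ⟨n, hn⟩ := exists_finset_pd a
  rw [evolutionary_evolutionary q r a hn, evolutionary_evolutionary r q a hn, evolutionary_sub,
    Finset.sum_comm (s := n) (t := n) (f := fun M N => shift M q * shift N r * pd N (pd M a))]
  rw [add_sub_add_comm, add_eq_left, sub_eq_zero]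
  refine Finset.sum_congr rfl fun M _ => Finset.sum_congr rfl fun N _ => ?_
  rw [pd_comm, mul_comm (shift M r)]

/-! ## Local functionals -/

theorem shift_sub_mem_totalDifferences (N : ℤ × ℤ) (a : A) :
    shift N a - a ∈ totalDifferences A := by
  -- Telescoping along multiples of one generator; the predecessor case covers the negative powers.
  have key : ∀ v : ℤ × ℤ, (∀ a : A, shift v a - a ∈ totalDifferences A) →
      ∀ (k : ℤ) (a : A), shift (k • v) a - a ∈ totalDifferences A := by
    intro v hv k
    induction k with
    | zero => intro a; simp [shift_zero]
    | succ k ih =>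
      intro a
      have := Submodule.add_mem _ (hv (shift ((k : ℤ) • v) a)) (ih a)
      rwa [← shift_add, sub_add_sub_cancel, add_comm, ← add_one_zsmul] at this
    | pred k ih =>
      intro a
      have := Submodule.sub_mem _ (ih a) (hv (shift ((-(k : ℤ) - 1) • v) a))
      rwa [← shift_add, ← one_add_zsmul, add_sub_cancel, sub_sub_sub_cancel_left] at this
  have h1 := key (1, 0) fun a => Submodule.mem_sup_left ⟨a, rfl⟩
  have h2 := key (0, 1) fun a => Submodule.mem_sup_right ⟨a, rfl⟩
  have := Submodule.add_mem _ (h1 N.1 (shift (N.2 • (0, 1)) a)) (h2 N.2 a)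
  rw [← shift_add, sub_add_sub_cancel] at this
  simpa using this

theorem integral_shift (N : ℤ × ℤ) (a : A) : integral (shift N a) = integral a := by
  rw [← sub_eq_zero, ← map_sub]
  exact (Submodule.Quotient.mk_eq_zero _).2 (shift_sub_mem_totalDifferences N a)

theorem varDer_integral (a : A) : varDer (integral a) = varDerDensity a := rfl

theorem exists_integral_eq (F : LocalFunctional A) : ∃ a : A, integral a = F :=
  Submodule.Quotient.mk_surjective _ F

theorem varDerDensity_eq_sum {a : A} {n : Finset (ℤ × ℤ)} (hn : ∀ N, N ∉ n → pd N a = 0) :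
    varDerDensity a = ∑ N ∈ n, shift (-N) (pd N a) :=
  finsum_eq_sum_of_support_subset _ fun N hN => by
    by_contra h
    exact hN (by simp [hn N h])

/-- Summation by parts. -/
theorem integral_varDerDensity_mul (a q : A) :
    integral (varDerDensity a * q) = integral (evolutionary q a) := by
  obtain ⟨n, hn⟩ := exists_finset_pd a
  rw [varDerDensity_eq_sum hn, evolutionary_eq_sum hn, Finset.sum_mul, map_sum, map_sum]
  refine Finset.sum_congr rfl fun N _ => ?_
  rw [← integral_shift N, map_mul, shift_shift_neg, mul_comm]

/-- Variational derivatives have self-adjoint linearization. -/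
theorem pd_varDerDensity (M : ℤ × ℤ) (a : A) :
    pd M (varDerDensity a) = shift M (pd (-M) (varDerDensity a)) := by
  obtain ⟨n, hn⟩ := exists_finset_pd a
  classical
  -- Adjoining `n - M` to `n` makes both the set and its translate by `M` contain every variable of
  -- `a`, so the sums on the two sides can be matched termwise under `N ↦ N + M`.
  have h1 : ∀ N, N ∉ n ∪ n.map (addRightEmbedding (-M)) → pd N a = 0 := fun N hN =>
    hn N fun h => hN (Finset.mem_union_left _ h)
  have h2 : ∀ N, N ∉ (n ∪ n.map (addRightEmbedding (-M))).map (addRightEmbedding M) →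
      pd N a = 0 := by
    refine fun N hN => hn N fun h => hN (Finset.mem_map.2 ⟨N - M, Finset.mem_union_right _ ?_, ?_⟩)
    · exact Finset.mem_map.2 ⟨N, h, by simp [sub_eq_add_neg]⟩
    · simp
  conv_lhs => rw [varDerDensity_eq_sum h1]
  rw [varDerDensity_eq_sum h2, Finset.sum_map, map_sum, map_sum, map_sum]
  refine Finset.sum_congr rfl fun N _ => ?_
  rw [pd_shift', pd_shift', ← shift_add, addRightEmbedding_apply,
    show M + -(N + M) = -N by abel, show -M - -(N + M) = N by abel,
    show M - -N = N + M by abel, pd_comm]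

theorem pd_varDer (M : ℤ × ℤ) (F : LocalFunctional A) :
    pd M (varDer F) = shift M (pd (-M) (varDer F)) := by
  obtain ⟨a, rfl⟩ := exists_integral_eq F
  exact pd_varDerDensity M a

/-! ## The morphism property in terms of coefficients -/

/-- The difference operator with coefficients `p K`, `K ∈ s`. -/
def opSum (s : Finset (ℤ × ℤ)) (p : ℤ × ℤ → A) (a : A) : A := ∑ K ∈ s, p K * shift K a

theorem opSum_add (s : Finset (ℤ × ℤ)) (p : ℤ × ℤ → A) (a b : A) :
    opSum s p (a + b) = opSum s p a + opSum s p b := by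
  simp [opSum, mul_add, Finset.sum_add_distrib]

theorem opSum_sub (s : Finset (ℤ × ℤ)) (p : ℤ × ℤ → A) (a b : A) :
    opSum s p (a - b) = opSum s p a - opSum s p b := by
  simp [opSum, mul_sub, Finset.sum_sub_distrib]

/-- The result of applying `∂/∂u_N`, followed by `b · ` and `𝓢^{-N}`, to the coefficients of the
operator, summed over `N`. -/
def opVar (n s : Finset (ℤ × ℤ)) (p : ℤ × ℤ → A) (a b : A) : A :=
  ∑ N ∈ n, shift (-N) (b * ∑ K ∈ s, pd N (p K) * shift K a)

/-- The linearization of the coefficients of the operator along `q`, applied to `b`. -/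
def opLin (s : Finset (ℤ × ℤ)) (p : ℤ × ℤ → A) (q b : A) : A :=
  ∑ K ∈ s, evolutionary q (p K) * shift K b

theorem evolutionary_opSum (s : Finset (ℤ × ℤ)) (p : ℤ × ℤ → A) (q b : A) :
    evolutionary q (opSum s p b) = opLin s p q b + opSum s p (evolutionary q b) := by
  rw [opSum, opSum, opLin, ← evolutionaryDer_apply, map_sum, ← Finset.sum_add_distrib]
  refine Finset.sum_congr rfl fun K _ => ?_
  rw [Derivation.leibniz, evolutionaryDer_apply, evolutionaryDer_apply, evolutionary_shift,
    smul_eq_mul, smul_eq_mul]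
  ring

/-- The symmetry of the coefficients of a skew-adjoint operator. -/
structure IsSkewCoeff (s : Finset (ℤ × ℤ)) (p : ℤ × ℤ → A) : Prop where
  neg_mem : ∀ K ∈ s, -K ∈ s
  coeff_neg : ∀ K, p (-K) = -shift (-K) (p K)
  eq_zero : ∀ K, K ∉ s → p K = 0

/-- The left side is the formal adjoint of the operator applied to `b`; the reflection `K ↦ -K`
turns skewness of the coefficients into `P* = -P`. -/
theorem IsSkewCoeff.sum_shift {s : Finset (ℤ × ℤ)} {p : ℤ × ℤ → A} (h : IsSkewCoeff s p) (b : A) :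
    ∑ K ∈ s, shift (-K) (b * p K) = -opSum s p b := by
  rw [opSum, ← Finset.sum_neg_distrib]
  refine Finset.sum_nbij' (fun K => -K) (fun K => -K) h.neg_mem h.neg_mem ?_ ?_ ?_ <;>
    intro K _
  · exact neg_neg K
  · exact neg_neg K
  · rw [h.coeff_neg, map_mul]
    ring

theorem IsSkewCoeff.integral_mul_opSum {s : Finset (ℤ × ℤ)} {p : ℤ × ℤ → A} (h : IsSkewCoeff s p)
    (a b : A) : integral (b * opSum s p a) = -integral (a * opSum s p b) := by
  have h1 : integral (a * opSum s p b) = -∑ K ∈ s, integral (a * shift (-K) (b * p K)) := by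
    rw [← map_sum, ← Finset.mul_sum, h.sum_shift, mul_neg, map_neg, neg_neg]
  rw [h1, neg_neg, opSum, Finset.mul_sum, map_sum]
  refine Finset.sum_congr rfl fun K _ => ?_
  rw [← integral_shift K (a * _), map_mul (shift K), shift_shift_neg]
  congr 1
  ring

/-- By the Leibniz rule a derivative falls on `b`, on `a`, or on a coefficient. The first case is
the adjoint linearization of `b` applied to `P a`, the second that of `a` applied to `P* b = -P b`,
and the hypotheses on `a` and `b` remove the adjoints. The third case is `opVar`. -/
theorem varDerDensity_mul_opSum {s n : Finset (ℤ × ℤ)} {p : ℤ × ℤ → A} (h : IsSkewCoeff s p)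
    (hn : ∀ K N, N ∉ n → pd N (p K) = 0) {a b : A}
    (ha : ∀ M, pd M a = shift M (pd (-M) a)) (hb : ∀ M, pd M b = shift M (pd (-M) b)) :
    varDerDensity (b * opSum s p a) =
      evolutionary (opSum s p a) b - evolutionary (opSum s p b) a + opVar n s p a b := by
  have adj : ∀ (q : A) {c : A}, (∀ M, pd M c = shift M (pd (-M) c)) →
      ∑ᶠ N : ℤ × ℤ, shift (-N) (q * pd N c) = evolutionary q c := by
    intro q c hc
    rw [evolutionary, ← finsum_comp_equiv (Equiv.neg (ℤ × ℤ)) (f := fun N => shift N q * pd N c)]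
    refine finsum_congr fun N => ?_
    rw [Equiv.neg_apply, hc (-N), neg_neg, map_mul]
  have expand : ∀ N, shift (-N) (pd N (b * opSum s p a)) =
      shift (-N) (opSum s p a * pd N b) +
        (∑ K ∈ s, shift (-N) (b * p K * shift K (pd (N - K) a)) +
          shift (-N) (b * ∑ K ∈ s, pd N (p K) * shift K a)) := by
    intro N
    rw [← map_sum, ← map_add, ← map_add, Derivation.leibniz, smul_eq_mul, smul_eq_mul, opSum,
      map_sum, Finset.mul_sum, Finset.mul_sum, ← Finset.sum_add_distrib, add_comm]
    congr 2
    refine Finset.sum_congr rfl fun K _ => ?_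
    rw [Derivation.leibniz, pd_shift', smul_eq_mul, smul_eq_mul]
    ring
  have fin : ∀ K : ℤ × ℤ,
      (Function.support fun N => shift (-N) (b * p K * shift K (pd (N - K) a))).Finite := by
    intro K
    refine ((pd_finite a).preimage (sub_left_injective (b := K)).injOn).subset fun N hN h0 => hN ?_
    simp [h0]
  change ∑ᶠ N : ℤ × ℤ, shift (-N) (pd N (b * opSum s p a)) = _
  have fin2 : (Function.support fun N =>
      ∑ K ∈ s, shift (-N) (b * p K * shift K (pd (N - K) a))).Finite :=
    (s.finite_toSet.biUnion fun K _ => fin K).subset fun N hN => by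
      obtain ⟨K, hK, h0⟩ := Finset.exists_ne_zero_of_sum_ne_zero hN
      exact Set.mem_biUnion hK h0
  have fin3 : (Function.support fun N =>
      shift (-N) (b * ∑ K ∈ s, pd N (p K) * shift K a)) ⊆ n := fun N hN => by
    by_contra h0
    refine hN ?_
    simp [hn _ N h0]
  simp only [expand]
  rw [finsum_add_distrib (support_shift_mul_pd_finite _ b)
    ((fin2.union (n.finite_toSet.subset fin3)).subset (Function.support_add _ _)),
    finsum_add_distrib fin2 (n.finite_toSet.subset fin3), adj _ hb, ← add_assoc,
    finsum_eq_sum_of_support_subset _ fin3, sub_eq_add_neg]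
  congr 2
  rw [finsum_sum_comm _ _ fun K _ => fin K, ← adj _ ha]
  -- Translating `N` by `K` moves `𝓢^K` off `a` and onto the other factor as `𝓢^{-K}`, which
  -- prepares for `P* = -P`.
  have reindex : ∀ K : ℤ × ℤ, ∑ᶠ N, shift (-N) (b * p K * shift K (pd (N - K) a)) =
      ∑ᶠ N, shift (-N) (shift (-K) (b * p K) * pd N a) := by
    intro K
    rw [← finsum_comp_equiv (Equiv.addRight K)
      (f := fun N => shift (-N) (b * p K * shift K (pd (N - K) a)))]
    refine finsum_congr fun N => ?_
    change shift (-(N + K)) (b * p K * shift K (pd (N + K - K) a)) = _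
    rw [add_sub_cancel_right, map_mul _ _ (shift K _), ← shift_add, map_mul (shift (-N)),
      ← shift_add, neg_add, neg_add_cancel_right]
  simp only [reindex]
  rw [← finsum_sum_comm _ _ fun K _ => support_shift_mul_pd_finite _ a, ← finsum_neg_distrib]
  · refine finsum_congr fun N => ?_
    rw [← map_sum, ← Finset.sum_mul, h.sum_shift, ← map_neg, neg_mul]

/-- The morphism property, reduced to an identity on the coefficients. -/
theorem morphism_iff {s n : Finset (ℤ × ℤ)} {p : ℤ × ℤ → A} (h : IsSkewCoeff s p)
    (hn : ∀ K N, N ∉ n → pd N (p K) = 0) {a b : A}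
    (ha : ∀ M, pd M a = shift M (pd (-M) a)) (hb : ∀ M, pd M b = shift M (pd (-M) b)) :
    opSum s p (varDerDensity (b * opSum s p a)) =
      evolutionary (opSum s p a) (opSum s p b) - evolutionary (opSum s p b) (opSum s p a) ↔
    opSum s p (opVar n s p a b) = opLin s p (opSum s p a) b - opLin s p (opSum s p b) a := by
  rw [varDerDensity_mul_opSum h hn ha hb, opSum_add, opSum_sub, evolutionary_opSum,
    evolutionary_opSum]
  constructor <;> intro h <;> linear_combination h

/-- Only the morphism property carries content: skew-symmetry is summation by parts, and since `{F,
∫a} = ∫ X_F(a)`, the Jacobi identity is the integral of the morphism property applied to a density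
of the third functional. -/
theorem isHamiltonian_iff {s n : Finset (ℤ × ℤ)} {p : ℤ × ℤ → A} (h : IsSkewCoeff s p)
    (hn : ∀ K N, N ∉ n → pd N (p K) = 0) {P : DiffOp A} (hP : ∀ a, opApply P a = opSum s p a) :
    IsHamiltonian P ↔ ∀ F G : LocalFunctional A,
      opSum s p (opVar n s p (varDer F) (varDer G)) =
        opLin s p (opSum s p (varDer F)) (varDer G) -
          opLin s p (opSum s p (varDer G)) (varDer F) := by
  have key : ∀ F G : LocalFunctional A,
      (∀ a, hamVectorField P (poissonBracket P F G) a =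
        hamVectorField P F (hamVectorField P G a) - hamVectorField P G (hamVectorField P F a)) ↔
      opSum s p (opVar n s p (varDer F) (varDer G)) =
        opLin s p (opSum s p (varDer F)) (varDer G) -
          opLin s p (opSum s p (varDer G)) (varDer F) := by
    intro F G
    rw [← morphism_iff h hn (fun M => pd_varDer M F) (fun M => pd_varDer M G)]
    simp only [hamVectorField, poissonBracket, varDer_integral, hP, evolutionary_commutator]
    refine ⟨fun h => ?_, fun h a => by rw [h]⟩
    -- The value on `u` recovers the characteristic.
    have := h gen
    rwa [evolutionary_gen, evolutionary_gen] at this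
  constructor
  · exact fun hH F G => (key F G).1 (hH.morphism F G)
  · intro hI
    have bracket : ∀ (F : LocalFunctional A) (a : A),
        poissonBracket P F (integral a) = integral (hamVectorField P F a) := by
      intro F a
      rw [poissonBracket, varDer_integral, integral_varDerDensity_mul]
      rfl
    have morph := fun F G => (key F G).2 (hI F G)
    refine ⟨fun F G => ?_, fun F G H => ?_, morph⟩
    · rw [poissonBracket, poissonBracket, hP, hP]
      exact h.integral_mul_opSum _ _
    · obtain ⟨a, rfl⟩ := exists_integral_eq H
      simp only [bracket]
      rw [morph, map_sub]

end Calculus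

end DifferenceAlgebra

/-! ## Vandermonde arguments -/

/-- Linearity extends the hypothesis from powers to all polynomials; the numerator of the Lagrange
polynomial at `x i` isolates `c i`. No division is used, so a domain suffices. -/
theorem eq_zero_of_forall_sum_mul_pow_eq_zero {ι R : Type*} [CommRing R] [IsDomain R]
    {x : ι → R} (hx : Function.Injective x) (W : Finset ι) (c : ι → R)
    (h : ∀ k : ℕ, ∑ i ∈ W, c i * x i ^ k = 0) : ∀ i ∈ W, c i = 0 := by
  classical
  intro i hi
  have hq : ∀ q : Polynomial R, ∑ i ∈ W, c i * q.eval (x i) = 0 := by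
    intro q
    induction q using Polynomial.induction_on' with
    | add p q hp hq => simp [mul_add, Finset.sum_add_distrib, hp, hq]
    | monomial k r =>
      have := congrArg (r * ·) (h k)
      simp only [Finset.mul_sum, mul_zero] at this
      rw [← this]
      refine Finset.sum_congr rfl fun j _ => ?_
      rw [Polynomial.eval_monomial]
      ring
  have h2 := hq (∏ j ∈ W.erase i, (Polynomial.X - Polynomial.C (x j)))
  simp only [Polynomial.eval_prod, Polynomial.eval_sub, Polynomial.eval_X, Polynomial.eval_C] at h2
  rw [Finset.sum_eq_single_of_mem i hi fun j hj hji => by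
    rw [Finset.prod_eq_zero (Finset.mem_erase.2 ⟨hji, hj⟩) (sub_self _), mul_zero]] at h2
  refine (mul_eq_zero.1 h2).resolve_right (Finset.prod_ne_zero_iff.2 fun j hj => ?_)
  exact sub_ne_zero.2 fun h3 => Finset.ne_of_mem_erase hj (hx h3).symm

/-- The one-variable statement is used twice: the powers of the first node separate the rows of `T`,
the powers of the second then separate the entries of each row. -/
theorem Finsupp.eq_zero_of_forall_linearCombination_pow {ι R : Type*} [CommRing R] [IsDomain R]
    {x : ι → R} (hx : Function.Injective x) (T : ι × ι →₀ R)
    (h : ∀ k l : ℕ, Finsupp.linearCombination R (fun i : ι × ι => x i.1 ^ k * x i.2 ^ l) T = 0) :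
    T = 0 := by
  classical
  set W := T.support.image Prod.fst ∪ T.support.image Prod.snd with hW
  have hsub : T.support ⊆ W ×ˢ W := fun i hi => Finset.mem_product.2
    ⟨Finset.mem_union_left _ (Finset.mem_image_of_mem _ hi),
      Finset.mem_union_right _ (Finset.mem_image_of_mem _ hi)⟩
  have h2 : ∀ k l : ℕ, ∑ i ∈ W, (∑ j ∈ W, T (i, j) * x j ^ l) * x i ^ k = 0 := by
    intro k l
    rw [← h k l, Finsupp.linearCombination_apply, Finsupp.sum_of_support_subset _ hsub,
      Finset.sum_product]
    · refine Finset.sum_congr rfl fun i _ => ?_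
      rw [Finset.sum_mul]
      refine Finset.sum_congr rfl fun j _ => ?_
      rw [smul_eq_mul]
      ring
    · simp
  ext ⟨i, j⟩
  by_contra hij
  obtain ⟨hi, hj⟩ := Finset.mem_product.1 (hsub (Finsupp.mem_support_iff.2 hij))
  exact hij (eq_zero_of_forall_sum_mul_pow_eq_zero hx W _ (fun l =>
    eq_zero_of_forall_sum_mul_pow_eq_zero hx W _ (fun k => h2 k l) i hi) j hj)

namespace DifferenceAlgebra

section Jacobi

variable {A : Type*} [CommRing A] [Algebra ℂ A] [DifferenceAlgebra A]

/-! ## The lattice Poisson bracket -/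

/-- The bracket `{u_X, u_Y}`. -/
def siteCoeff (p : ℤ × ℤ → A) (X Y : ℤ × ℤ) : A := shift X (p (Y - X))

/-- The bracket `{u_X, a}`. -/
def siteBracket (s : Finset (ℤ × ℤ)) (p : ℤ × ℤ → A) (X : ℤ × ℤ) (a : A) : A :=
  ∑ K ∈ s, shift X (p K) * pd (X + K) a

theorem shift_siteCoeff (p : ℤ × ℤ → A) (Z X Y : ℤ × ℤ) :
    shift Z (siteCoeff p X Y) = siteCoeff p (Z + X) (Z + Y) := by
  rw [siteCoeff, siteCoeff, ← shift_add, add_sub_add_left_eq_sub]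

theorem shift_siteBracket (s : Finset (ℤ × ℤ)) (p : ℤ × ℤ → A) (Z X : ℤ × ℤ) (a : A) :
    shift Z (siteBracket s p X a) = siteBracket s p (Z + X) (shift Z a) := by
  rw [siteBracket, siteBracket, map_sum]
  refine Finset.sum_congr rfl fun K _ => ?_
  rw [map_mul, ← shift_add, pd_shift', show Z + X + K - Z = X + K by abel]

theorem IsSkewCoeff.siteCoeff_swap {s : Finset (ℤ × ℤ)} {p : ℤ × ℤ → A} (h : IsSkewCoeff s p)
    (X Y : ℤ × ℤ) : siteCoeff p X Y = -siteCoeff p Y X := by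
  rw [siteCoeff, siteCoeff, ← neg_sub X Y, h.coeff_neg, map_neg, ← shift_add]
  congr 2
  abel_nf

theorem siteBracket_neg (s : Finset (ℤ × ℤ)) (p : ℤ × ℤ → A) (X : ℤ × ℤ) (a : A) :
    siteBracket s p X (-a) = -siteBracket s p X a := by
  simp [siteBracket]

theorem siteBracket_zero (s : Finset (ℤ × ℤ)) (p : ℤ × ℤ → A) (X : ℤ × ℤ) :
    siteBracket s p X 0 = 0 := by
  simp [siteBracket]

theorem IsSkewCoeff.sum_shift_sub {s : Finset (ℤ × ℤ)} {p : ℤ × ℤ → A} (h : IsSkewCoeff s p)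
    (X : ℤ × ℤ) (a : A) :
    ∑ K ∈ s, shift (X - K) (p K) * pd (X - K) a = -siteBracket s p X a := by
  rw [siteBracket, ← Finset.sum_neg_distrib]
  refine Finset.sum_nbij' (fun K => -K) (fun K => -K) h.neg_mem h.neg_mem ?_ ?_ ?_
  · intro K _; exact neg_neg K
  · intro K _; exact neg_neg K
  · intro K _
    rw [h.coeff_neg, map_neg, ← shift_add, ← sub_eq_add_neg, neg_mul, neg_neg]

/-- The trivector whose vanishing is the morphism property, with the symbols of its two arguments
replaced by formal variables. -/
def jacobiSymbol (n s : Finset (ℤ × ℤ)) (p : ℤ × ℤ → A) : (ℤ × ℤ) × (ℤ × ℤ) →₀ A :=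
  (∑ K ∈ s, ∑ N ∈ n, ∑ J ∈ s,
      Finsupp.single (K - N + J, K - N) (p K * shift (K - N) (pd N (p J)))) -
    (∑ K ∈ s, ∑ N ∈ n, ∑ J ∈ s, Finsupp.single (N + J, K) (shift N (p J) * pd N (p K))) +
    ∑ K ∈ s, ∑ N ∈ n, ∑ J ∈ s, Finsupp.single (K, N + J) (shift N (p J) * pd N (p K))

/-- Recovers the coefficient identity from its symbol. The exponents `K - N + J` and `K - N` come
from applying `𝓢^K 𝓢^{-N}` to `b · 𝓢^J a`; those of the other two sums come from `𝓢^N 𝓢^J` on one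
argument and `𝓢^K` on the other. -/
theorem linearCombination_jacobiSymbol {n s : Finset (ℤ × ℤ)} {p : ℤ × ℤ → A}
    (hn : ∀ K N, N ∉ n → pd N (p K) = 0) (a b : A) :
    Finsupp.linearCombination A
        (fun i : (ℤ × ℤ) × (ℤ × ℤ) => shift i.1 a * shift i.2 b) (jacobiSymbol n s p) =
      opSum s p (opVar n s p a b) -
        (opLin s p (opSum s p a) b - opLin s p (opSum s p b) a) := by
  have lin : ∀ a b : A, opLin s p (opSum s p a) b =
      ∑ K ∈ s, ∑ N ∈ n, ∑ J ∈ s, shift N (p J) * pd N (p K) * (shift (N + J) a * shift K b) := by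
    intro a b
    rw [opLin]
    refine Finset.sum_congr rfl fun K _ => ?_
    rw [evolutionary_eq_sum (hn K), Finset.sum_mul]
    refine Finset.sum_congr rfl fun N _ => ?_
    rw [opSum, map_sum, Finset.sum_mul, Finset.sum_mul]
    refine Finset.sum_congr rfl fun J _ => ?_
    rw [map_mul, ← shift_add]
    ring
  rw [lin, lin, jacobiSymbol, map_add, map_sub, sub_sub_eq_add_sub, add_sub_right_comm]
  simp only [map_sum, Finsupp.linearCombination_single, smul_eq_mul]
  congr 1
  · congr 1
    rw [opSum]
    refine Finset.sum_congr rfl fun K _ => ?_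
    rw [opVar, map_sum, Finset.mul_sum]
    refine Finset.sum_congr rfl fun N _ => ?_
    rw [← shift_add, ← sub_eq_add_neg, map_mul, map_sum, Finset.mul_sum, Finset.mul_sum]
    refine Finset.sum_congr rfl fun J _ => ?_
    rw [map_mul, ← shift_add]
    ring
  · simp only [mul_comm (shift (_ + _) b)]

/-- At a fixed pair of exponents each triple sum collapses to a single sum, one iterated bracket of
the generators at the sites `0`, `M`, `L`: in the first sum `N = K - M` and `J = L - M`, in the
second `K = M` and `N = L - J`, and the third is the second with `L` and `M` exchanged. -/
theorem jacobiSymbol_apply {n s : Finset (ℤ × ℤ)} {p : ℤ × ℤ → A} (h : IsSkewCoeff s p)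
    (hn : ∀ K N, N ∉ n → pd N (p K) = 0) (L M : ℤ × ℤ) :
    jacobiSymbol n s p (L, M) =
      siteBracket s p 0 (siteCoeff p M L) + siteBracket s p L (siteCoeff p 0 M) +
        siteBracket s p M (siteCoeff p L 0) := by
  classical
  have hzero : ∀ K, siteCoeff p 0 K = p K := fun K => by rw [siteCoeff, shift_zero, sub_zero]
  have sum2 : ∀ L M : ℤ × ℤ, (∑ K ∈ s, ∑ N ∈ n, ∑ J ∈ s,
      if N + J = L ∧ K = M then shift N (p J) * pd N (p K) else 0) =
        -siteBracket s p L (siteCoeff p 0 M) := by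
    intro L M
    rw [hzero, ← h.sum_shift_sub]
    have h1 : ∀ K, (∑ N ∈ n, ∑ J ∈ s,
        if N + J = L ∧ K = M then shift N (p J) * pd N (p K) else 0) =
        if K = M then ∑ J ∈ s, shift (L - J) (p J) * pd (L - J) (p K) else 0 := by
      intro K
      split_ifs with hK
      · rw [Finset.sum_comm]
        refine Finset.sum_congr rfl fun J _ => ?_
        simp only [← eq_sub_iff_add_eq, and_true, hK]
        rw [Finset.sum_ite_eq']
        split_ifs with h2
        · rfl
        · rw [hn _ _ h2, mul_zero]
      · simp [hK]
    simp only [h1]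
    rw [Finset.sum_ite_eq']
    split_ifs with h2
    · rfl
    · simp [h.eq_zero _ h2]
  have sum1 : (∑ K ∈ s, ∑ N ∈ n, ∑ J ∈ s,
      if K - N + J = L ∧ K - N = M then p K * shift (K - N) (pd N (p J)) else 0) =
        siteBracket s p 0 (siteCoeff p M L) := by
    rw [siteBracket]
    refine Finset.sum_congr rfl fun K _ => ?_
    rw [zero_add, shift_zero, siteCoeff, pd_shift']
    have h1 : ∀ N, (∑ J ∈ s,
        if K - N + J = L ∧ K - N = M then p K * shift (K - N) (pd N (p J)) else 0) =
        if N = K - M then p K * shift M (pd N (p (L - M))) else 0 := by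
      intro N
      split_ifs with hN
      · have : K - N = M := by rw [hN]; abel
        simp only [this, and_true, ← eq_sub_iff_add_eq']
        rw [Finset.sum_ite_eq']
        split_ifs with h2
        · rfl
        · simp [h.eq_zero _ h2]
      · refine Finset.sum_eq_zero fun J _ => if_neg fun h2 => hN ?_
        rw [← h2.2]; abel
    simp only [h1]
    rw [Finset.sum_ite_eq']
    split_ifs with h2
    · rfl
    · simp [hn _ _ h2]
  have e2 := sum2 L M
  have e3 := sum2 M L
  rw [jacobiSymbol, h.siteCoeff_swap L 0, siteBracket_neg, ← e3, ← sum1]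
  simp only [Finsupp.add_apply, Finsupp.sub_apply, Finsupp.finsetSum_apply, Finsupp.single_apply,
    Prod.mk.injEq]
  rw [e2, sub_neg_eq_add]
  simp only [and_comm]

/-- The density `u^(k+1)/(k+1)` does it. These functionals alone suffice to extract the coefficients
of the bilinear identity. -/
theorem varDer_pow (k : ℕ) : ∃ F : LocalFunctional A, varDer F = (gen : A) ^ k := by
  refine ⟨integral (((k : ℂ) + 1)⁻¹ • gen ^ (k + 1)), ?_⟩
  rw [varDer_integral, map_smul, varDerDensity_eq_sum (n := {0}), Finset.sum_singleton, neg_zero,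
    shift_zero, Derivation.leibniz_pow, pd_zero_gen, if_pos rfl, add_tsub_cancel_right,
    ← Nat.cast_smul_eq_nsmul ℂ, smul_smul, Nat.cast_add, Nat.cast_one,
    inv_mul_cancel₀ (Nat.cast_add_one_ne_zero k), one_smul, smul_eq_mul, mul_one]
  intro N hN
  rw [Derivation.leibniz_pow, pd_zero_gen, if_neg (by simpa using hN)]
  simp

theorem shift_gen_injective [Nontrivial A] :
    Function.Injective fun N : ℤ × ℤ => shift N (gen : A) :=
  (algebraicIndependent (A := A)).injective

/-- The Jacobi identity for the bracket of the generators. -/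
theorem siteBracket_jacobi [IsDomain A] {s n : Finset (ℤ × ℤ)} {p : ℤ × ℤ → A}
    (h : IsSkewCoeff s p) (hn : ∀ K N, N ∉ n → pd N (p K) = 0)
    (hI : ∀ F G : LocalFunctional A, opSum s p (opVar n s p (varDer F) (varDer G)) =
        opLin s p (opSum s p (varDer F)) (varDer G) -
          opLin s p (opSum s p (varDer G)) (varDer F)) (X Y Z : ℤ × ℤ) :
    siteBracket s p X (siteCoeff p Y Z) + siteBracket s p Y (siteCoeff p Z X) +
      siteBracket s p Z (siteCoeff p X Y) = 0 := by
  have hT : jacobiSymbol n s p = 0 := by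
    refine Finsupp.eq_zero_of_forall_linearCombination_pow shift_gen_injective _ fun k l => ?_
    obtain ⟨F, hF⟩ := varDer_pow (A := A) k
    obtain ⟨G, hG⟩ := varDer_pow (A := A) l
    have := linearCombination_jacobiSymbol (s := s) hn (varDer F) (varDer G)
    rw [hI, sub_self, hF, hG] at this
    simpa only [map_pow] using this
  -- By translation invariance one site may be taken to be the origin; applying `𝓢^X` afterwards
  -- restores the general position.
  have h0 := jacobiSymbol_apply h hn (Z - X) (Y - X)
  rw [hT, Finsupp.zero_apply] at h0
  have := congrArg (shift X) h0
  simp only [map_zero, map_add, shift_siteBracket, shift_siteCoeff, add_sub_cancel, add_zero]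
    at this
  rw [this]
  ring

end Jacobi

section Support

variable {A : Type*} [CommRing A] [Algebra ℂ A] [DifferenceAlgebra A]

/-! ## Nearest-neighbour Poisson brackets -/

theorem shift_eq_zero_iff (N : ℤ × ℤ) (a : A) : shift N a = 0 ↔ a = 0 :=
  EmbeddingLike.map_eq_zero_iff

theorem IsSkewCoeff.coeff_neg_eq_zero {s : Finset (ℤ × ℤ)} {p : ℤ × ℤ → A} (h : IsSkewCoeff s p)
    {K : ℤ × ℤ} : p (-K) = 0 ↔ p K = 0 := by
  rw [h.coeff_neg, neg_eq_zero, shift_eq_zero_iff]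

theorem siteCoeff_eq_zero {p : ℤ × ℤ → A} {X Y : ℤ × ℤ} : siteCoeff p X Y = 0 ↔ p (Y - X) = 0 :=
  shift_eq_zero_iff _ _

theorem siteCoeff_zero_left (p : ℤ × ℤ → A) (K : ℤ × ℤ) : siteCoeff p 0 K = p K := by
  rw [siteCoeff, shift_zero, sub_zero]

theorem IsSkewCoeff.siteBracket_eq_sum {s : Finset (ℤ × ℤ)} {p : ℤ × ℤ → A} (h : IsSkewCoeff s p)
    (X : ℤ × ℤ) {a : A} {n : Finset (ℤ × ℤ)} (hn : ∀ N, N ∉ n → pd N a = 0) :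
    siteBracket s p X a = ∑ N ∈ n, siteCoeff p X N * pd N a := by
  have h1 : ∑ᶠ N : ℤ × ℤ, siteCoeff p X N * pd N a = ∑ N ∈ n, siteCoeff p X N * pd N a :=
    finsum_eq_sum_of_support_subset _ fun N hN => by
      by_contra h0
      exact hN (by simp [hn N h0])
  have h2 : ∑ᶠ K : ℤ × ℤ, siteCoeff p X (X + K) * pd (X + K) a = siteBracket s p X a := by
    rw [siteBracket]
    simp only [siteCoeff, add_sub_cancel_left]
    refine finsum_eq_sum_of_support_subset _ fun K hK => ?_
    by_contra h0
    exact hK (by simp [h.eq_zero K h0])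
  rw [← h1, ← h2]
  exact finsum_comp_equiv (Equiv.addLeft X) (f := fun N => siteCoeff p X N * pd N a)

/-- If `a` involves only `u_Y` and `u_Z`, and `u_X` does not interact with `u_Z`, the chain rule
leaves one term. -/
theorem IsSkewCoeff.siteBracket_pair {s : Finset (ℤ × ℤ)} {p : ℤ × ℤ → A} (h : IsSkewCoeff s p)
    (X : ℤ × ℤ) {a : A} {Y Z : ℤ × ℤ} (ha : ∀ N, N ≠ Y → N ≠ Z → pd N a = 0)
    (hX : siteCoeff p X Z = 0) : siteBracket s p X a = siteCoeff p X Y * pd Y a := by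
  classical
  rw [h.siteBracket_eq_sum X (n := {Y, Z}) fun N hN => ha N (by grind) (by grind)]
  by_cases hYZ : Y = Z
  · subst hYZ; simp
  · rw [Finset.sum_pair hYZ, hX, zero_mul, add_zero]

/-- If the bracket with `u_{N + κ}` kills `a` at the extremal variables `u_N` of `a`, where `κ` is
the extremal neighbour, then there are no such variables. -/
theorem IsSkewCoeff.lt_of_pd_ne_zero [IsDomain A] {s : Finset (ℤ × ℤ)} {p : ℤ × ℤ → A}
    (h : IsSkewCoeff s p) {a : A} (ℓ : ℤ × ℤ →+ ℤ) {κ : ℤ × ℤ} (hκ : p κ ≠ 0)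
    (hℓ : ∀ K, p K ≠ 0 → K ≠ κ → ℓ K < ℓ κ) (t : ℤ)
    (ha : ∀ N, pd N a ≠ 0 → t ≤ ℓ N → siteBracket s p (N + κ) a = 0) (N : ℤ × ℤ)
    (hN : pd N a ≠ 0) : ℓ N < t := by
  by_contra! hlt
  obtain ⟨M, ⟨hM, hMt⟩, hmax⟩ := Set.exists_max_image {N | pd N a ≠ 0 ∧ t ≤ ℓ N} ℓ
    ((pd_finite a).subset fun N hN => hN.1) ⟨N, hN, hlt⟩
  have h0 := ha M hM hMt
  -- For a neighbour `K ≠ -κ` one has `ℓ K > -ℓ κ`, so `u_{M+κ+K}` lies strictly beyond the extremal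
  -- `u_M` and does not occur in `a`. Only `K = -κ` survives, and its term is a nonzero coefficient
  -- times `∂a/∂u_M`.
  rw [siteBracket, Finset.sum_eq_single (-κ)] at h0
  · rw [add_neg_cancel_right, mul_eq_zero, shift_eq_zero_iff, h.coeff_neg_eq_zero] at h0
    exact h0.elim hκ hM
  · intro K _ hK
    by_cases hp : p K = 0
    · simp [hp]
    · have h1 := hℓ (-K) (by rwa [Ne, h.coeff_neg_eq_zero]) fun h => hK (neg_eq_iff_eq_neg.1 h)
      have h2 : pd (M + κ + K) a = 0 := by
        by_contra h3
        rw [map_neg] at h1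
        have h4 : ℓ (M + κ + K) = ℓ M + ℓ κ + ℓ K := by rw [map_add, map_add]
        have := hmax (M + κ + K) ⟨h3, by omega⟩
        omega
      rw [h2, mul_zero]
  · intro hs
    exact absurd (h.coeff_neg_eq_zero.1 (h.eq_zero _ hs)) hκ

/-- A translation-invariant Poisson bracket in which only nearest neighbours interact; `v`, `w` is
a basis of the lattice with dual basis `ξ`, `η`. -/
structure IsNearestNeighbour (s : Finset (ℤ × ℤ)) (p : ℤ × ℤ → A) (v w : ℤ × ℤ)
    (ξ η : ℤ × ℤ →+ ℤ) : Prop where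
  skew : IsSkewCoeff s p
  jacobi : ∀ X Y Z : ℤ × ℤ, siteBracket s p X (siteCoeff p Y Z) +
    siteBracket s p Y (siteCoeff p Z X) + siteBracket s p Z (siteCoeff p X Y) = 0
  mem : ∀ K, p K ≠ 0 → K = v ∨ K = -v ∨ K = w ∨ K = -w
  ξv : ξ v = 1
  ξw : ξ w = 0
  ηv : η v = 0
  ηw : η w = 1
  ext_zero : ∀ K, ξ K = 0 → η K = 0 → K = 0

/-! ### Consequences of the Jacobi identity for nearest-neighbour brackets -/

namespace IsNearestNeighbour

variable {s : Finset (ℤ × ℤ)} {p : ℤ × ℤ → A} {v w : ℤ × ℤ} {ξ η : ℤ × ℤ →+ ℤ}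

theorem swap (h : IsNearestNeighbour s p v w ξ η) : IsNearestNeighbour s p w v η ξ where
  skew := h.skew
  jacobi := h.jacobi
  mem K hK := by rcases h.mem K hK with h | h | h | h <;> simp [h]
  ξv := h.ηw
  ξw := h.ηv
  ηv := h.ξw
  ηw := h.ξv
  ext_zero K h1 h2 := h.ext_zero K h2 h1

/-- Puts adjacency into integer coordinates for `omega`. The alternatives along `w` retain `p w ≠
0`, so that they disappear when `p w` vanishes. -/
theorem coord (h : IsNearestNeighbour s p v w ξ η) {K : ℤ × ℤ} (hK : p K ≠ 0) :
    (ξ K = 1 ∧ η K = 0) ∨ (ξ K = -1 ∧ η K = 0) ∨ (p w ≠ 0 ∧ ξ K = 0 ∧ η K = 1) ∨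
      (p w ≠ 0 ∧ ξ K = 0 ∧ η K = -1) := by
  have h1 := h.ξv
  have h2 := h.ξw
  have h3 := h.ηv
  have h4 := h.ηw
  rcases h.mem K hK with rfl | rfl | rfl | rfl
  · simp [*]
  · simp [*]
  · simp [*]
  · rw [Ne, h.skew.coeff_neg_eq_zero] at hK
    simp [*]

/-- If `u_X` interacts with neither `u_0` nor `u_v`, the Jacobi identity for `X`, `0`, `v` has only
one term. -/
theorem siteBracket_eq_zero (h : IsNearestNeighbour s p v w ξ η) {X : ℤ × ℤ} (h1 : p X = 0)
    (h2 : p (X - v) = 0) : siteBracket s p X (p v) = 0 := by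
  have := h.jacobi X 0 v
  rwa [siteCoeff_zero_left, siteCoeff_eq_zero.2 h2,
    siteCoeff_eq_zero.2 (by rwa [zero_sub, h.skew.coeff_neg_eq_zero]), siteBracket_zero,
    siteBracket_zero, add_zero, add_zero] at this

/-- If `u_N` is an extremal variable of `p v` in a direction whose extremal neighbour is `κ`, then
`u_{N+κ}` cannot commute with `p v`, so `N + κ` must be adjacent to `0` or `v`. Varying the
direction confines `N` to `0 ≤ ξ N ≤ 1` and `η N = 0`. -/
theorem pd_coeff [IsDomain A] (h : IsNearestNeighbour s p v w ξ η) (N : ℤ × ℤ) (h0 : N ≠ 0)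
    (hv : N ≠ v) : pd N (p v) = 0 := by
  by_contra hN
  have hpv : p v ≠ 0 := fun h1 => hN (by rw [h1, map_zero])
  have hpv' : p (-v) ≠ 0 := by rwa [Ne, h.skew.coeff_neg_eq_zero]
  have h1 := h.ξv
  have h2 := h.ξw
  have h3 := h.ηv
  have h4 := h.ηw
  have vanish : ∀ X, ¬((ξ X = 1 ∧ η X = 0) ∨ (ξ X = -1 ∧ η X = 0) ∨
      (p w ≠ 0 ∧ ξ X = 0 ∧ η X = 1) ∨ (p w ≠ 0 ∧ ξ X = 0 ∧ η X = -1)) → p X = 0 := by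
    intro X hX
    by_contra h5
    exact hX (h.coord h5)
  have key : ∀ (ℓ : ℤ × ℤ →+ ℤ) (κ : ℤ × ℤ) (t : ℤ), p κ ≠ 0 →
      (∀ K, p K ≠ 0 → K ≠ κ → ℓ K < ℓ κ) →
      (∀ N, pd N (p v) ≠ 0 → t ≤ ℓ N → p (N + κ) = 0 ∧ p (N + κ - v) = 0) →
      ∀ N, pd N (p v) ≠ 0 → ℓ N < t := fun ℓ κ t hκ hℓ ht =>
    h.skew.lt_of_pd_ne_zero ℓ hκ hℓ t fun N hN hNt =>
      h.siteBracket_eq_zero (ht N hN hNt).1 (ht N hN hNt).2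
  have le_one := key ξ v 2 hpv (fun K hK hne => by
      rcases h.mem K hK with rfl | rfl | rfl | rfl
      · exact absurd rfl hne
      all_goals first | omega | (simp only [map_neg]; omega)) fun N _ ht => by
    constructor <;> refine vanish _ ?_ <;> simp only [map_add, map_sub] <;> omega
  have nonneg := key (-ξ) (-v) 1 hpv' (fun K hK hne => by
      rcases h.mem K hK with rfl | rfl | rfl | rfl
      on_goal 2 => exact absurd rfl hne
      all_goals (simp only [map_neg, AddMonoidHom.neg_apply]; omega)) fun N _ ht => by
    rw [AddMonoidHom.neg_apply] at ht
    constructor <;> refine vanish _ ?_ <;> simp only [map_add, map_sub, map_neg] <;> omega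
  -- When `p w ≠ 0` the directions `±η` with extremal neighbours `±w` suffice. When `p w = 0` there
  -- is no neighbour off the `v`-axis, and slanted directions are needed.
  have hη : η N = 0 := by
    by_cases hw : p w = 0
    · have hne : ∀ K, p K ≠ 0 → K = v ∨ K = -v := by
        intro K hK
        rcases h.mem K hK with rfl | rfl | rfl | rfl
        · exact Or.inl rfl
        · exact Or.inr rfl
        · exact absurd hw hK
        · exact absurd (h.skew.coeff_neg_eq_zero.2 hw) hK
      -- The extremal neighbour is still `v`. As `ξ N ≤ 1`, the bound `ξ N + 2 η N ≥ 2` forces `η N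
      -- > 0`, so `N + v` is off the axis and commutes with `p v`. With weight one on `η`, the point
      -- `ξ N = 0`, `η N = 1` would not be excluded.
      have up := key (ξ + (η + η)) v 2 hpv (fun K hK hne' => by
          rcases hne K hK with rfl | rfl
          · exact absurd rfl hne'
          · simp only [AddMonoidHom.add_apply, map_neg]; omega) fun N hN ht => by
        have := le_one N hN
        simp only [AddMonoidHom.add_apply] at ht
        constructor <;> refine vanish _ ?_ <;> simp only [map_add, map_sub, hw, ne_eq,
            not_true_eq_false, false_and, or_false] <;> omega
      have down := key (ξ - (η + η)) v 2 hpv (fun K hK hne' => by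
          rcases hne K hK with rfl | rfl
          · exact absurd rfl hne'
          · simp only [AddMonoidHom.add_apply, AddMonoidHom.sub_apply, map_neg]; omega)
        fun N hN ht => by
        have := le_one N hN
        simp only [AddMonoidHom.add_apply, AddMonoidHom.sub_apply] at ht
        constructor <;> refine vanish _ ?_ <;> simp only [map_add, map_sub, hw, ne_eq,
            not_true_eq_false, false_and, or_false] <;> omega
      have a1 := up N hN
      have a2 := down N hN
      have a3 := nonneg N hN
      simp only [AddMonoidHom.add_apply, AddMonoidHom.sub_apply, AddMonoidHom.neg_apply] at a1 a2 a3
      omega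
    · have hw' : p (-w) ≠ 0 := by rwa [Ne, h.skew.coeff_neg_eq_zero]
      have up := key η w 1 hw (fun K hK hne => by
          rcases h.mem K hK with rfl | rfl | rfl | rfl
          on_goal 3 => exact absurd rfl hne
          all_goals first | omega | (simp only [map_neg]; omega)) fun N _ ht => by
        constructor <;> refine vanish _ ?_ <;> simp only [map_add, map_sub] <;> omega
      have down := key (-η) (-w) 1 hw' (fun K hK hne => by
          rcases h.mem K hK with rfl | rfl | rfl | rfl
          on_goal 4 => exact absurd rfl hne
          all_goals (simp only [map_neg, AddMonoidHom.neg_apply]; omega)) fun N _ ht => by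
        rw [AddMonoidHom.neg_apply] at ht
        constructor <;> refine vanish _ ?_ <;> simp only [map_add, map_sub, map_neg] <;> omega
      have a1 := up N hN
      have a2 := down N hN
      rw [AddMonoidHom.neg_apply] at a2
      omega
  have a1 := le_one N hN
  have a2 := nonneg N hN
  rw [AddMonoidHom.neg_apply] at a2
  have hξ : ξ N = 0 ∨ ξ N = 1 := by omega
  rcases hξ with hξ | hξ
  · exact h0 (h.ext_zero N hξ hη)
  · exact hv (sub_eq_zero.1 (h.ext_zero _ (by rw [map_sub, hξ, h1, sub_self])
      (by rw [map_sub, hη, h3, sub_self])))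

/-- Where a neighbour `κ` of `0` is not a neighbour of `-v`, the coefficients of the two brackets
have proportional derivatives along `u_0`. -/
theorem pd_zero_proportional [IsDomain A] (h : IsNearestNeighbour s p v w ξ η) {κ : ℤ × ℤ}
    (hκ : ∀ N, N ≠ 0 → N ≠ κ → pd N (p κ) = 0) (hκv : p (-κ - v) = 0) :
    shift (-κ) (p κ) * pd 0 (p v) = p v * pd 0 (shift (-κ) (p κ)) := by
  have hJ := h.jacobi (-κ) 0 v
  have e : siteCoeff p (-κ) 0 = shift (-κ) (p κ) := by rw [siteCoeff, zero_sub, neg_neg]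
  have h1 : siteCoeff p v (-κ) = 0 := siteCoeff_eq_zero.2 hκv
  have h2 : siteCoeff p (-κ) v = 0 := by rw [h.skew.siteCoeff_swap, h1, neg_zero]
  have h3 : ∀ N, N ≠ 0 → N ≠ -κ → pd N (shift (-κ) (p κ)) = 0 := by
    intro N hN hNκ
    rw [pd_shift', hκ, map_zero]
    · intro h4; exact hNκ (sub_eq_zero.1 h4)
    · intro h4; exact hN (by rw [sub_neg_eq_add, add_eq_right] at h4; exact h4)
  rw [h1, siteBracket_zero, add_zero, siteCoeff_zero_left, e,
    h.skew.siteBracket_pair (-κ) (Y := 0) (Z := v) h.pd_coeff h2,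
    h.skew.siteBracket_pair v (Y := 0) (Z := -κ) h3 h1, h.skew.siteCoeff_swap v 0,
    siteCoeff_zero_left, e] at hJ
  linear_combination hJ

theorem pd_coeff_neg [IsDomain A] (h : IsNearestNeighbour s p v w ξ η) (N : ℤ × ℤ) (h0 : N ≠ 0)
    (hv : N ≠ -v) : pd N (p (-v)) = 0 := by
  rw [h.skew.coeff_neg, map_neg, pd_shift', h.pd_coeff, map_zero, neg_zero]
  · intro h4; exact hv (sub_eq_zero.1 h4)
  · intro h4; exact h0 (by rw [sub_neg_eq_add, add_eq_right] at h4; exact h4)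

/-- The sites `-v`, `-w`, `w` are the neighbour positions of `0` other than `v`, and none of them is
adjacent to `v`: the nearest-neighbour graph has no triangles. -/
theorem coeff_add_eq_zero (h : IsNearestNeighbour s p v w ξ η) :
    p (-v - v) = 0 ∧ p (-w - v) = 0 ∧ p (w - v) = 0 := by
  have h1 := h.ξv
  have h2 := h.ξw
  have h3 := h.ηv
  have h4 := h.ηw
  refine ⟨?_, ?_, ?_⟩ <;> by_contra h5 <;> have h6 := h.coord h5 <;>
    simp only [map_sub, map_neg] at h6 <;> omega

/-- The consequences of the Jacobi identity used for the classification. -/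
theorem proportional [IsDomain A] (h : IsNearestNeighbour s p v w ξ η) :
    shift (-v) (p v) * pd 0 (p v) = p v * pd 0 (shift (-v) (p v)) ∧
    shift (-w) (p w) * pd 0 (p v) = p v * pd 0 (shift (-w) (p w)) ∧
    p w * pd 0 (p v) = p v * pd 0 (p w) := by
  obtain ⟨h1, h2, h3⟩ := h.coeff_add_eq_zero
  refine ⟨h.pd_zero_proportional h.pd_coeff h1, h.pd_zero_proportional h.swap.pd_coeff h2, ?_⟩
  -- The neighbour `κ = -w`: here `𝓢^w p(-w) = -p w`, and the sign cancels on both sides.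
  have := h.pd_zero_proportional h.swap.pd_coeff_neg (by rwa [neg_neg])
  rw [neg_neg, h.skew.coeff_neg, map_neg, shift_shift_neg, map_neg] at this
  linear_combination -this

end IsNearestNeighbour

end Support

end DifferenceAlgebra

section Holomorphic

open TopologicalSpace (Opens)

variable {U : Opens ℂ}

/-! ## Analytic continuation in finitely many variables -/

/-- A point of `U^s` extended by the coordinates of `x`. -/
theorem exists_extend {s : Finset (ℤ × ℤ)} {y : s → ℂ} (hy : ∀ i, y i ∈ U) (x : ℤ × ℤ → U) :
    ∃ X : ℤ × ℤ → U, (fun i : s => (X i : ℂ)) = y ∧ ∀ N, N ∉ s → X N = x N := by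
  classical
  refine ⟨fun N => if h : N ∈ s then ⟨y ⟨N, h⟩, hy _⟩ else x N, ?_, fun N hN => by simp [hN]⟩
  ext i
  simp

theorem isOpen_forall_mem (s : Finset (ℤ × ℤ)) : IsOpen {y : s → ℂ | ∀ i, y i ∈ U} := by
  simp only [Set.ofPred_forall]
  exact isOpen_iInter_of_finite fun i => U.isOpen.preimage (continuous_apply i)

/-- A finite power of the connected set `U` is connected, so the identity theorem applies. -/
theorem eq_zero_of_eventually_eq_zero [ConnectedSpace U] {s : Finset (ℤ × ℤ)} {G : (s → ℂ) → ℂ}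
    (hG : AnalyticOnNhd ℂ G {y | ∀ i, y i ∈ U}) {z : s → ℂ} (hz : ∀ i, z i ∈ U)
    (h : ∀ᶠ y in 𝓝 z, G y = 0) {y : s → ℂ} (hy : ∀ i, y i ∈ U) : G y = 0 := by
  have hconn : IsPreconnected {y : s → ℂ | ∀ i, y i ∈ U} := by
    have h1 : IsPreconnected (U : Set ℂ) := isPreconnected_iff_preconnectedSpace.2 inferInstance
    have h2 := isPreconnected_univ_pi (X := fun _ : s => ℂ) (s := fun _ => (U : Set ℂ)) fun _ => h1
    convert h2 using 1
    ext y
    simp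
  exact hG.eqOn_zero_of_preconnected_of_eventuallyEq_zero hconn hz h hy

namespace HolomorphicFunctions

theorem exists_ne_zero {F : HolomorphicFunctions U} (hF : F ≠ 0) :
    ∃ x, (F : (ℤ × ℤ → U) → ℂ) x ≠ 0 := by
  by_contra! h
  exact hF (Subtype.ext (funext h))

/-- Near a point where `F` does not vanish, `F'` must vanish identically; analytic continuation
makes it zero everywhere. -/
instance instNoZeroDivisors [ConnectedSpace U] : NoZeroDivisors (HolomorphicFunctions U) where
  eq_zero_or_eq_zero_of_mul_eq_zero := by
    classical
    intro F F' hFF'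
    by_contra! hne
    obtain ⟨x, hx⟩ := exists_ne_zero hne.1
    obtain ⟨s, h⟩ := F.2
    obtain ⟨t, h'⟩ := F'.2
    obtain ⟨G, hG, hGF⟩ := h.mono (t := s ∪ t) Finset.subset_union_left
    obtain ⟨G', hG', hGF'⟩ := h'.mono (t := s ∪ t) Finset.subset_union_right
    have hxU : (fun i => (x i : ℂ) : (s ∪ t : Finset (ℤ × ℤ)) → ℂ) ∈
        {y : (s ∪ t : Finset (ℤ × ℤ)) → ℂ | ∀ i, y i ∈ U} := fun i => (x i).2
    rw [hGF] at hx
    refine hne.2 (Subtype.ext (funext fun y => ?_))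
    rw [hGF']
    refine eq_zero_of_eventually_eq_zero hG' hxU ?_ fun i => (y i).2
    filter_upwards [(hG _ hxU).continuousAt.eventually_ne hx,
      (isOpen_forall_mem _).mem_nhds hxU] with z hz hzU
    obtain ⟨X, rfl, -⟩ := exists_extend hzU x
    have : (F : (ℤ × ℤ → U) → ℂ) X * (F' : (ℤ × ℤ → U) → ℂ) X = 0 := congrFun
      (congrArg Subtype.val hFF') X
    rw [hGF, hGF'] at this
    exact (mul_eq_zero.1 this).resolve_left hz

instance instIsDomain [ConnectedSpace U] : IsDomain (HolomorphicFunctions U) :=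
  have : Nontrivial (HolomorphicFunctions U) := inferInstance
  NoZeroDivisors.to_isDomain _

/-- If the fraction `D / K` does not depend on the variables `u_N`, `N ∈ T`, and vanishes when these
are frozen at `x`, then it vanishes. -/
theorem eq_zero_of_pd_mul_eq [ConnectedSpace U] (D K : HolomorphicFunctions U) (T : Set (ℤ × ℤ))
    (x : ℤ × ℤ → U) (hKx : (K : (ℤ × ℤ → U) → ℂ) x ≠ 0)
    (hpd : ∀ N ∈ T, holoPd U N D * K = D * holoPd U N K)
    (hD : ∀ y : ℤ × ℤ → U, (∀ N ∈ T, y N = x N) → (D : (ℤ × ℤ → U) → ℂ) y = 0) : D = 0 := by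
  classical
  obtain ⟨s, h⟩ := D.2
  obtain ⟨t, h'⟩ := K.2
  obtain ⟨G, hG, hGD⟩ := h.mono (t := s ∪ t) Finset.subset_union_left
  obtain ⟨H, hH, hHK⟩ := h'.mono (t := s ∪ t) Finset.subset_union_right
  generalize s ∪ t = r at G hG hGD H hH hHK
  have hxU : (fun i => (x i : ℂ) : r → ℂ) ∈ {y : r → ℂ | ∀ i, y i ∈ U} := fun i => (x i).2
  have hpdG : ∀ z : r → ℂ, (∀ i, z i ∈ U) → ∀ i : r, (i : ℤ × ℤ) ∈ T →
      fderiv ℂ G z (Pi.single i 1) * H z = G z * fderiv ℂ H z (Pi.single i 1) := by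
    intro z hz i hi
    obtain ⟨X, rfl, -⟩ := exists_extend hz x
    have h1 := congrFun (congrArg Subtype.val (hpd i hi)) X
    change partialDeriv i (D : (ℤ × ℤ → U) → ℂ) X * (K : (ℤ × ℤ → U) → ℂ) X =
      (D : (ℤ × ℤ → U) → ℂ) X * partialDeriv i (K : (ℤ × ℤ → U) → ℂ) X at h1
    rwa [partialDeriv_eq i.2 hG hGD, partialDeriv_eq i.2 hH hHK, hGD, hHK] at h1
  rw [hHK] at hKx
  refine Subtype.ext (funext fun y => ?_)
  rw [hGD]
  -- It suffices to work in a small ball around `x` on which the denominator has no zeros.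
  refine eq_zero_of_eventually_eq_zero hG hxU ?_ fun i => (y i).2
  obtain ⟨ε, hε, hball⟩ := Metric.mem_nhds_iff.1 (Filter.inter_mem
    ((hH _ hxU).continuousAt.eventually_ne hKx) ((isOpen_forall_mem r).mem_nhds hxU))
  filter_upwards [Metric.ball_mem_nhds _ hε] with z hz
  set x₀ : r → ℂ := fun i => (x i : ℂ)
  -- The coordinates in `T` are moved to their values at `x`, which stays inside the ball of the sup
  -- metric. `G` vanishes at `z'`, and the quotient `G / H` is constant on the segment from `z'` to
  -- `z`, whose direction involves only coordinates in `T`.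
  let z' : r → ℂ := fun i => if (i : ℤ × ℤ) ∈ T then x₀ i else z i
  have hz' : z' ∈ Metric.ball x₀ ε := by
    rw [Metric.mem_ball, dist_pi_lt_iff hε] at hz ⊢
    intro i
    by_cases hi : (i : ℤ × ℤ) ∈ T
    · simpa [z', hi] using hε
    · simpa [z', hi] using hz i
  have hGz' : G z' = 0 := by
    obtain ⟨X, hX, hXs⟩ := exists_extend (hball hz').2 x
    rw [← hX, ← hGD]
    refine hD X fun N hN => ?_
    by_cases hNr : N ∈ r
    · have := congrFun hX ⟨N, hNr⟩
      simp only [z', hN, if_true, x₀] at this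
      exact Subtype.ext this
    · exact hXs N hNr
  have hdir : ∀ y : r → ℂ, (∀ i, y i ∈ U) →
      fderiv ℂ G y (z - z') * H y = G y * fderiv ℂ H y (z - z') := by
    intro y hy
    have hsum : z - z' = ∑ i : r, (z - z') i • (Pi.single i 1 : r → ℂ) :=
      pi_eq_sum_univ' (z - z')
    rw [hsum, map_sum, map_sum, Finset.sum_mul, Finset.mul_sum]
    refine Finset.sum_congr rfl fun i _ => ?_
    by_cases hi : (i : ℤ × ℤ) ∈ T
    · rw [map_smul, map_smul, smul_eq_mul, smul_eq_mul, mul_assoc, hpdG y hy i hi]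
      ring
    · simp [z', hi]
  let c : ℂ → (r → ℂ) := fun w => z' + w • (z - z')
  have hc : ∀ w, HasDerivAt c (z - z') w := fun w => by
    have := ((hasDerivAt_id w).smul_const (z - z')).const_add z'
    rwa [one_smul] at this
  have hcc : Continuous c := continuous_iff_continuousAt.2 fun w => (hc w).continuousAt
  have hconv : Convex ℝ (c ⁻¹' Metric.ball x₀ ε) := by
    intro w₁ h₁ w₂ h₂ a b ha hb hab
    have hab' : (a : ℂ) + b = 1 := by exact_mod_cast hab
    have : c (a • w₁ + b • w₂) = a • c w₁ + b • c w₂ := by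
      ext i
      simp only [c, Pi.add_apply, Pi.smul_apply, smul_eq_mul, Complex.real_smul]
      linear_combination -z' i * hab'
    rw [Set.mem_preimage, this]
    exact convex_ball x₀ ε h₁ h₂ ha hb hab
  have hq : ∀ w ∈ c ⁻¹' Metric.ball x₀ ε, HasDerivAt (fun w => G (c w) / H (c w)) 0 w := by
    intro w hw
    have h1 := (hG _ (hball hw).2).differentiableAt.hasFDerivAt.comp_hasDerivAt w (hc w)
    have h2 := (hH _ (hball hw).2).differentiableAt.hasFDerivAt.comp_hasDerivAt w (hc w)
    have h3 := h1.div h2 (hball hw).1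
    simp only [Function.comp, hdir _ (hball hw).2, sub_self, zero_div] at h3
    exact h3
  have h01 := hconv.is_const_of_fderivWithin_eq_zero (𝕜 := ℂ) (f := fun w => G (c w) / H (c w))
    (fun w hw => (hq w hw).differentiableAt.differentiableWithinAt)
    (fun w hw => by
      rw [fderivWithin_of_isOpen (Metric.isOpen_ball.preimage hcc) hw, (hq w hw).hasFDerivAt.fderiv]
      ext; simp)
    (x := 1) (y := 0) (by simpa [c] using hz) (by simpa [c] using hz')
  simp only [c, one_smul, zero_smul, add_sub_cancel, add_zero, hGz', zero_div] at h01
  exact (div_eq_zero_iff.1 h01).resolve_right (hball hz).1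

/-- Freezing all variables but `u` at `x`. -/
def freeze (x : ℤ × ℤ → U) : HolomorphicFunctions U →+* HolomorphicFunctions U where
  toFun F := ⟨fun y => (F : (ℤ × ℤ → U) → ℂ) (Function.update x 0 (y 0)), by
    classical
    obtain ⟨s, G, hG, hGF⟩ := F.2
    refine ⟨{0}, fun y => G fun i => if (i : ℤ × ℤ) = 0 then y ⟨0, by simp⟩ else x i,
      fun y hy => ?_, fun y => ?_⟩
    · refine AnalyticAt.comp (hG _ fun i => ?_) (analyticAt_pi_iff.2 fun i => ?_)
      · split_ifs
        · exact hy _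
        · exact (x i).2
      · split_ifs
        · exact (ContinuousLinearMap.proj (R := ℂ)
            (φ := fun _ : ({0} : Finset (ℤ × ℤ)) => ℂ) ⟨0, by simp⟩).analyticAt _
        · exact analyticAt_const
    · refine (hGF _).trans (congrArg G (funext fun i => ?_))
      by_cases hi : (i : ℤ × ℤ) = 0
      · simp only [hi, if_true, Function.update_self]
      · simp only [hi, if_false, ne_eq, not_false_eq_true, Function.update_of_ne]⟩
  map_one' := rfl
  map_mul' _ _ := rfl
  map_zero' := rfl
  map_add' _ _ := rfl

theorem freeze_apply (x : ℤ × ℤ → U) (F : HolomorphicFunctions U) (y : ℤ × ℤ → U) :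
    (freeze x F : (ℤ × ℤ → U) → ℂ) y = (F : (ℤ × ℤ → U) → ℂ) (Function.update x 0 (y 0)) := rfl

/-- Freezing leaves `u` free. This is what carries the differential equation in `u` over to the
frozen function. -/
theorem holoPd_zero_freeze (x : ℤ × ℤ → U) (F : HolomorphicFunctions U) :
    holoPd U 0 (freeze x F) = freeze x (holoPd U 0 F) := by
  ext y
  change deriv (slice (freeze x F : (ℤ × ℤ → U) → ℂ) y 0) (y 0) =
    deriv (slice (F : (ℤ × ℤ → U) → ℂ) (Function.update x 0 (y 0)) 0)
      (Function.update x 0 (y 0) 0)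
  rw [Function.update_self]
  congr 1
  funext z
  by_cases h : z ∈ U <;> simp [slice, h, freeze_apply]

theorem holoPd_freeze {N : ℤ × ℤ} (hN : N ≠ 0) (x : ℤ × ℤ → U) (F : HolomorphicFunctions U) :
    holoPd U N (freeze x F) = 0 := by
  ext y
  change deriv (slice (freeze x F : (ℤ × ℤ → U) → ℂ) y N) (y N) = 0
  have : slice (freeze x F : (ℤ × ℤ → U) → ℂ) y N =ᶠ[𝓝 (y N : ℂ)]
      fun _ => (freeze x F : (ℤ × ℤ → U) → ℂ) y := by
    filter_upwards [U.isOpen.mem_nhds (y N).2] with z hz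
    have hz' : z ∈ U := hz
    simp [slice, hz', freeze_apply, Function.update_of_ne hN.symm]
  rw [this.deriv_eq]
  simp

theorem freeze_ne_zero {x : ℤ × ℤ → U} {F : HolomorphicFunctions U}
    (hF : (F : (ℤ × ℤ → U) → ℂ) x ≠ 0) : freeze x F ≠ 0 := by
  intro h
  apply hF
  have := freeze_apply x F x
  rwa [Function.update_eq_self, h, eq_comm] at this

end HolomorphicFunctions

/-! ## Meromorphic functions -/

/-- Multiplication by `G²K` clears denominators. Freezing is defined on holomorphic functions only,
so the equation must first be brought to polynomial form in numerators and denominators. -/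
theorem derivation_div_eq_iff {R L : Type*} [CommRing R] [Field L] [Algebra R L] [Algebra ℂ L]
    (hinj : Function.Injective (algebraMap R L)) (D : Derivation ℂ L L) (d : R → R)
    (hd : ∀ a, D (algebraMap R L a) = algebraMap R L (d a)) (F H : R) {G K : R} (hG : G ≠ 0)
    (hK : K ≠ 0) :
    D (algebraMap R L F / algebraMap R L G) = algebraMap R L H / algebraMap R L K *
        (algebraMap R L F / algebraMap R L G) ↔
      (d F * G - F * d G) * K = H * F * G := by
  have hG' : algebraMap R L G ≠ 0 := (map_ne_zero_iff _ hinj).2 hG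
  have hK' : algebraMap R L K ≠ 0 := (map_ne_zero_iff _ hinj).2 hK
  rw [Derivation.leibniz_div, hd, hd, ← hinj.eq_iff]
  simp only [smul_eq_mul, map_mul, map_sub]
  field_simp

namespace MeromorphicFunctions

open HolomorphicFunctions

theorem algebraMap_ne_zero {F : HolomorphicFunctions U} (hF : F ≠ 0) :
    algebraMap _ (MeromorphicFunctions U) F ≠ 0 :=
  (map_ne_zero_iff _ (IsFractionRing.injective _ (MeromorphicFunctions U))).2 hF

variable [ConnectedSpace U]

instance instField : Field (MeromorphicFunctions U) := FractionRing.field _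

theorem exists_div (f : MeromorphicFunctions U) : ∃ F G : HolomorphicFunctions U, G ≠ 0 ∧
    f = algebraMap _ (MeromorphicFunctions U) F / algebraMap _ (MeromorphicFunctions U) G := by
  obtain ⟨F, G, hG, rfl⟩ := IsFractionRing.div_surjective (A := HolomorphicFunctions U) f
  exact ⟨F, G, nonZeroDivisors.ne_zero hG, rfl⟩

theorem pd_algebraMap (N : ℤ × ℤ) (F : HolomorphicFunctions U) :
    pd N (algebraMap _ (MeromorphicFunctions U) F) =
      algebraMap _ (MeromorphicFunctions U) (holoPd U N F) :=
  derivFrac_algebraMap (holoPd U N) F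

/-- The equation `∂f/∂u_N = ψ f` in terms of numerators and denominators. -/
theorem pd_div_eq_iff (N : ℤ × ℤ) (F H : HolomorphicFunctions U) {G K : HolomorphicFunctions U}
    (hG : G ≠ 0) (hK : K ≠ 0) :
    pd N (algebraMap _ (MeromorphicFunctions U) F / algebraMap _ (MeromorphicFunctions U) G) =
      algebraMap _ (MeromorphicFunctions U) H / algebraMap _ (MeromorphicFunctions U) K *
        (algebraMap _ (MeromorphicFunctions U) F / algebraMap _ (MeromorphicFunctions U) G) ↔
    (holoPd U N F * G - F * holoPd U N G) * K = H * F * G :=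
  derivation_div_eq_iff (IsFractionRing.injective _ (MeromorphicFunctions U)) (pd N) (holoPd U N)
    (pd_algebraMap N) F H hG hK

theorem pd_div_eq_zero_iff (N : ℤ × ℤ) (F : HolomorphicFunctions U) {G : HolomorphicFunctions U}
    (hG : G ≠ 0) :
    pd N (algebraMap _ (MeromorphicFunctions U) F / algebraMap _ (MeromorphicFunctions U) G) = 0 ↔
    holoPd U N F * G = F * holoPd U N G := by
  have h := pd_div_eq_iff N F 0 hG one_ne_zero
  rw [map_zero, zero_div, zero_mul] at h
  rw [h, mul_one, zero_mul, zero_mul, sub_eq_zero]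

/-- A meromorphic function with vanishing partial derivatives is constant. -/
theorem exists_eq_algebraMap {f : MeromorphicFunctions U} (hf : ∀ N : ℤ × ℤ, pd N f = 0) :
    ∃ c : ℂ, f = algebraMap ℂ (MeromorphicFunctions U) c := by
  obtain ⟨H, K, hK, rfl⟩ := exists_div f
  obtain ⟨x, hx⟩ := exists_ne_zero hK
  set c : ℂ := (H : (ℤ × ℤ → U) → ℂ) x / (K : (ℤ × ℤ → U) → ℂ) x
  -- The constant is the value of the fraction at a point where the denominator does not vanish; all
  -- variables are then treated as frozen.
  have h0 : H - c • K = 0 := by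
    refine eq_zero_of_pd_mul_eq (H - c • K) K Set.univ x hx (fun N _ => ?_) fun y hy => ?_
    · have := (pd_div_eq_zero_iff N H hK).1 (hf N)
      rw [map_sub, Derivation.map_smul, sub_mul, sub_mul, this, smul_mul_assoc, smul_mul_assoc,
        mul_comm K]
    · obtain rfl : y = x := funext fun N => hy N trivial
      change (H : (ℤ × ℤ → U) → ℂ) y - c * (K : (ℤ × ℤ → U) → ℂ) y = 0
      rw [div_mul_cancel₀ _ hx, sub_self]
  refine ⟨c, ?_⟩
  rw [div_eq_iff (algebraMap_ne_zero hK), sub_eq_zero.1 h0, Algebra.smul_def, map_mul]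
  rfl

/-- A function of the single variable `u` that is the logarithmic derivative of a meromorphic
function of several variables is the logarithmic derivative of a function of `u`. -/
theorem exists_isFunctionOfGen {f ψ : MeromorphicFunctions U} (hf : f ≠ 0)
    (hψ : IsFunctionOfGen ψ) (hfψ : pd 0 f = ψ * f) :
    ∃ φ : MeromorphicFunctions U, φ ≠ 0 ∧ IsFunctionOfGen φ ∧ pd 0 φ = ψ * φ := by
  obtain ⟨F, G, hG, rfl⟩ := exists_div f
  obtain ⟨H, K, hK, rfl⟩ := exists_div ψ
  have hF : F ≠ 0 := fun h => hf (by rw [h, map_zero, zero_div])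
  -- A point where the numerator and denominator of `f` and the denominator of `ψ` are all nonzero,
  -- so that none of the three is lost by freezing.
  obtain ⟨x, hx⟩ := exists_ne_zero (mul_ne_zero (mul_ne_zero hF hG) hK)
  have hx' : (F : (ℤ × ℤ → U) → ℂ) x * (G : (ℤ × ℤ → U) → ℂ) x *
    (K : (ℤ × ℤ → U) → ℂ) x ≠ 0 := hx
  have hFx := left_ne_zero_of_mul (left_ne_zero_of_mul hx')
  have hGx := right_ne_zero_of_mul (left_ne_zero_of_mul hx')
  have hKx := right_ne_zero_of_mul hx'
  -- Freezing does not change `ψ = H/K`: the quotient of the left side by `K` is `freeze x H -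
  -- freeze x K · ψ`, which involves `u` alone and vanishes when the other variables are those of
  -- `x`.
  have hcross : freeze x H * K - H * freeze x K = 0 := by
    refine eq_zero_of_pd_mul_eq _ K {N | N ≠ 0} x hKx (fun N hN => ?_) fun y hy => ?_
    · have := (pd_div_eq_zero_iff N H hK).1 (hψ N hN)
      rw [map_sub, Derivation.leibniz, Derivation.leibniz, holoPd_freeze hN, holoPd_freeze hN]
      simp only [smul_eq_mul, mul_zero, add_zero, zero_add]
      linear_combination -freeze x K * this
    · have : y = Function.update x 0 (y 0) := by
        funext N
        by_cases hN : N = 0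
        · subst hN; simp
        · rw [Function.update_of_ne hN, hy N hN]
      change (freeze x H : (ℤ × ℤ → U) → ℂ) y * (K : (ℤ × ℤ → U) → ℂ) y -
        (H : (ℤ × ℤ → U) → ℂ) y * (freeze x K : (ℤ × ℤ → U) → ℂ) y = 0
      rw [freeze_apply, freeze_apply, ← this, sub_self]
  have hψ' : algebraMap _ (MeromorphicFunctions U) H / algebraMap _ (MeromorphicFunctions U) K =
      algebraMap _ (MeromorphicFunctions U) (freeze x H) /
        algebraMap _ (MeromorphicFunctions U) (freeze x K) := by
    rw [div_eq_div_iff (algebraMap_ne_zero hK) (algebraMap_ne_zero (freeze_ne_zero hKx)),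
      ← map_mul, ← map_mul, sub_eq_zero.1 hcross]
  have hF' := algebraMap_ne_zero (freeze_ne_zero hFx)
  have hG' := algebraMap_ne_zero (freeze_ne_zero hGx)
  refine ⟨algebraMap _ (MeromorphicFunctions U) (freeze x F) /
    algebraMap _ (MeromorphicFunctions U) (freeze x G), div_ne_zero hF' hG', fun N hN => ?_, ?_⟩
  · rw [pd_div_eq_zero_iff N _ (freeze_ne_zero hGx), holoPd_freeze hN, holoPd_freeze hN, zero_mul,
      mul_zero]
  · rw [hψ', pd_div_eq_iff 0 _ _ (freeze_ne_zero hGx) (freeze_ne_zero hKx), holoPd_zero_freeze,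
      holoPd_zero_freeze]
    have := congrArg (freeze x) ((pd_div_eq_iff 0 F H hG hK).1 hfψ)
    simpa only [map_mul, map_sub] using this

end MeromorphicFunctions

end Holomorphic

namespace DifferenceAlgebra

section Operators

variable {A : Type*} [CommRing A] [Algebra ℂ A] [DifferenceAlgebra A]

/-! ## Coefficients of first-order operators -/

/-- The coefficients of `firstOrderOp f g`. -/
def firstOrderCoeff (f g : A) (K : ℤ × ℤ) : A :=
  if K = (1, 0) then f else if K = (0, 1) then g
  else if K = (0, -1) then -shift (0, -1) g else if K = (-1, 0) then -shift (-1, 0) f else 0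

/-- The exponents of a first-order operator. -/
def neighbours : Finset (ℤ × ℤ) := {(1, 0), (0, 1), (0, -1), (-1, 0)}

theorem isSkewCoeff_firstOrderCoeff (f g : A) :
    IsSkewCoeff neighbours (firstOrderCoeff f g) where
  neg_mem := by decide
  coeff_neg := by
    rintro ⟨i, j⟩
    by_cases h1 : ((i, j) : ℤ × ℤ) = (1, 0)
    · obtain ⟨rfl, rfl⟩ := Prod.mk.inj h1
      simp [firstOrderCoeff]
    by_cases h2 : ((i, j) : ℤ × ℤ) = (0, 1)
    · obtain ⟨rfl, rfl⟩ := Prod.mk.inj h2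
      simp [firstOrderCoeff]
    by_cases h3 : ((i, j) : ℤ × ℤ) = (0, -1)
    · obtain ⟨rfl, rfl⟩ := Prod.mk.inj h3
      have := shift_shift_neg (0, 1) g
      simp [firstOrderCoeff] at this ⊢
      exact this.symm
    by_cases h4 : ((i, j) : ℤ × ℤ) = (-1, 0)
    · obtain ⟨rfl, rfl⟩ := Prod.mk.inj h4
      have := shift_shift_neg (1, 0) f
      simp [firstOrderCoeff] at this ⊢
      exact this.symm
    have h : ∀ k l : ℤ, ((-i, -j) : ℤ × ℤ) = (k, l) ↔ (i, j) = (-k, -l) := by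
      simp [neg_eq_iff_eq_neg]
    simp only [firstOrderCoeff, Prod.neg_mk, h, neg_neg, neg_zero, h1, h2, h3, h4, if_false,
      map_zero]
  eq_zero K hK := by
    simp only [neighbours, Finset.mem_insert, Finset.mem_singleton, not_or] at hK
    simp [firstOrderCoeff, hK]

theorem firstOrderOp_eq (f g : A) : firstOrderOp f g =
    ∑ K ∈ neighbours, SkewMonoidAlgebra.single (Multiplicative.ofAdd K) (firstOrderCoeff f g K) := by
  have h1 : ∀ (a : A) (K : ℤ × ℤ),
      opFun a * opShift A K = SkewMonoidAlgebra.single (Multiplicative.ofAdd K) a := fun a K => by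
    rw [opFun, opShift, SkewMonoidAlgebra.single_mul_single, one_mul, one_smul, mul_one]
  have h2 : ∀ (a : A) (K : ℤ × ℤ), opShift A K * opFun a =
      SkewMonoidAlgebra.single (Multiplicative.ofAdd K) (shift K a) := fun a K => by
    rw [opShift_mul_opFun, h1]
  rw [firstOrderOp, h1, h1, h2, h2, neighbours, Finset.sum_insert (by decide),
    Finset.sum_insert (by decide), Finset.sum_insert (by decide), Finset.sum_singleton]
  simp [firstOrderCoeff, SkewMonoidAlgebra.single_neg]
  abel

theorem opApply_firstOrderOp (f g a : A) :
    opApply (firstOrderOp f g) a = opSum neighbours (firstOrderCoeff f g) a := by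
  have h : ∀ (s : Finset (ℤ × ℤ)) (p : ℤ × ℤ → A),
      opApply (∑ K ∈ s, SkewMonoidAlgebra.single (Multiplicative.ofAdd K) (p K)) a =
        opSum s p a := by
    intro s p
    induction s using Finset.induction_on with
    | empty => simp [opApply, opSum, SkewMonoidAlgebra.sum_zero_index]
    | insert K s hK ih =>
      rw [Finset.sum_insert hK, opSum, Finset.sum_insert hK, ← opSum, ← ih]
      simp only [opApply]
      rw [SkewMonoidAlgebra.sum_add_index' (fun _ => zero_mul _) (fun _ _ _ => add_mul _ _ _),
        SkewMonoidAlgebra.sum_single_index (zero_mul _)]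
      rfl
  rw [firstOrderOp_eq, h]

theorem coeff_firstOrderOp (f g : A) (K : ℤ × ℤ) :
    (firstOrderOp f g).coeff (Multiplicative.ofAdd K) = firstOrderCoeff f g K := by
  rw [firstOrderOp_eq, neighbours, Finset.sum_insert (by decide),
    Finset.sum_insert (by decide), Finset.sum_insert (by decide), Finset.sum_singleton]
  simp only [SkewMonoidAlgebra.coeff_add, Finsupp.add_apply, SkewMonoidAlgebra.coeff_single,
    Finsupp.single_apply, EmbeddingLike.apply_eq_iff_eq, eq_comm (b := K)]
  by_cases h1 : K = (1, 0)
  · subst h1; simp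
  by_cases h2 : K = (0, 1)
  · subst h2; simp
  by_cases h3 : K = (0, -1)
  · subst h3; simp
  by_cases h4 : K = (-1, 0)
  · subst h4; simp
  simp [firstOrderCoeff, h1, h2, h3, h4]

theorem firstOrderOp_inj {f g f' g' : A} :
    firstOrderOp f g = firstOrderOp f' g' ↔ f = f' ∧ g = g' := by
  refine ⟨fun h => ⟨?_, ?_⟩, fun h => by rw [h.1, h.2]⟩
  · simpa [coeff_firstOrderOp, firstOrderCoeff] using
      congrArg (fun P : DiffOp A => P.coeff (Multiplicative.ofAdd (1, 0))) h
  · simpa [coeff_firstOrderOp, firstOrderCoeff] using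
      congrArg (fun P : DiffOp A => P.coeff (Multiplicative.ofAdd (0, 1))) h

/-- Since `φ 𝓢^K ∘ φ = φ 𝓢^K(φ) 𝓢^K`, with `firstOrderOp_inj` the equality of operators in the
classification amounts to `f = α φ 𝓢₁φ` and `g = β φ 𝓢₂φ`. -/
theorem normalFormOp_eq (α β : ℂ) (φ : A) : normalFormOp α β φ =
    firstOrderOp (α • (φ * shift (1, 0) φ)) (β • (φ * shift (0, 1) φ)) := by
  have h1 : ∀ (c : ℂ) (K : ℤ × ℤ),
      opFun φ * (opFun (algebraMap ℂ A c) * opShift A K) * opFun φ =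
        SkewMonoidAlgebra.single (Multiplicative.ofAdd K) (c • (φ * shift K φ)) := by
    intro c K
    rw [mul_assoc, mul_assoc, opShift_mul_opFun, opFun, opFun, opFun, opShift]
    simp only [SkewMonoidAlgebra.single_mul_single, one_mul, one_smul, mul_one, Algebra.smul_def]
    congr 1
    ring
  rw [normalFormOp, firstOrderOp_eq, neighbours, Finset.sum_insert (by decide),
    Finset.sum_insert (by decide), Finset.sum_insert (by decide), Finset.sum_singleton]
  rw [mul_sub, mul_sub, mul_add, sub_mul, sub_mul, add_mul, h1, h1, h1, h1]
  have e1 : shift (-1, 0) (shift (1, 0) φ) = φ := shift_neg_shift (1, 0) φ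
  have e2 : shift (0, -1) (shift (0, 1) φ) = φ := shift_neg_shift (0, 1) φ
  simp [firstOrderCoeff, SkewMonoidAlgebra.single_neg, e1, e2, mul_comm φ]
  abel

/-! ## Operators in normal form -/

/-- The odd linear form `K.1 α + K.2 β` takes the values `α`, `β`, `-β`, `-α` on the four exponents,
which treats them uniformly and makes skewness evident. -/
theorem firstOrderCoeff_normalForm (α β : ℂ) (φ : A) {K : ℤ × ℤ} (hK : K ∈ neighbours) :
    firstOrderCoeff (α • (φ * shift (1, 0) φ)) (β • (φ * shift (0, 1) φ)) K =
      (K.1 * α + K.2 * β) • (φ * shift K φ) := by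
  have s1 : shift (-1, 0) (shift (1, 0) φ) = φ := shift_neg_shift (1, 0) φ
  have s2 : shift (0, -1) (shift (0, 1) φ) = φ := shift_neg_shift (0, 1) φ
  simp only [neighbours, Finset.mem_insert, Finset.mem_singleton] at hK
  rcases hK with rfl | rfl | rfl | rfl <;> simp [firstOrderCoeff, s1, s2, mul_comm φ]

/-- The identity on coefficients behind the morphism property, for operators `φ K ∘ φ` with
`φ = φ(u)` and `K` a skew-adjoint operator with constant coefficients. -/
theorem opSum_opVar_of_normalForm {φ : A} (hφ : IsFunctionOfGen φ) {s n : Finset (ℤ × ℤ)}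
    (hs : ∀ K ∈ s, -K ∈ s) (h0 : 0 ∈ n) (hsn : s ⊆ n) {c : ℤ × ℤ → ℂ} (hc : ∀ K, c (-K) = -c K)
    {p : ℤ × ℤ → A} (hp : ∀ K ∈ s, p K = c K • (φ * shift K φ)) (a b : A) :
    opSum s p (opVar n s p a b) =
      opLin s p (opSum s p a) b - opLin s p (opSum s p b) a := by
  set φ' : A := pd 0 φ with hφ'
  -- `Q = K ∘ φ`, so that `P = φ Q`.
  let Q : A → A := fun a => ∑ K ∈ s, c K • shift K (φ * a)
  have hQ : ∀ a, opSum s p a = φ * Q a := by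
    intro a
    rw [opSum, Finset.mul_sum]
    refine Finset.sum_congr rfl fun K hK => ?_
    rw [hp K hK, map_mul, smul_mul_assoc, mul_smul_comm, mul_assoc]
  have hpdφ : ∀ N K : ℤ × ℤ, pd N (shift K φ) = if N = K then shift K φ' else 0 := by
    intro N K
    rw [pd_shift']
    split_ifs with h
    · rw [h, sub_self]
    · rw [hφ _ (sub_ne_zero.2 h), map_zero]
  have hpdφ0 : ∀ N : ℤ × ℤ, pd N φ = if N = 0 then φ' else 0 := by
    intro N
    simpa only [shift_zero] using hpdφ N 0
  -- The coefficient of `𝓢^K` involves only `u_0` and `u_K`. The derivatives along `u_0` reassemble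
  -- to `b Q a`; those along `u_K`, by oddness of `c`, to `-a Q b`.
  have hV : opVar n s p a b = φ' * (b * Q a - a * Q b) := by
    have h1 : ∀ N : ℤ × ℤ, shift (-N) (b * ∑ K ∈ s, pd N (p K) * shift K a) =
        (if N = 0 then φ' * b * Q a else 0) +
          ∑ K ∈ s, if N = K then c K • (shift (-K) (φ * b) * (φ' * a)) else 0 := by
      intro N
      have h2 : b * ∑ K ∈ s, pd N (p K) * shift K a = (if N = 0 then φ' * b * Q a else 0) +
          ∑ K ∈ s, if N = K then c K • (b * φ * shift K (φ' * a)) else 0 := by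
        have h3 : (if N = 0 then φ' * b * Q a else 0) =
            ∑ K ∈ s, if N = 0 then φ' * b * (c K • shift K (φ * a)) else 0 := by
          split_ifs
          · rw [Finset.mul_sum]
          · simp
        rw [h3, Finset.mul_sum, ← Finset.sum_add_distrib]
        refine Finset.sum_congr rfl fun K hK => ?_
        rw [hp K hK, Derivation.map_smul, Derivation.leibniz, hpdφ, hpdφ0]
        simp only [smul_eq_mul, map_mul, Algebra.smul_def]
        split_ifs <;> ring
      rw [h2, map_add, map_sum]
      congr 1
      · split_ifs with h
        · rw [h, neg_zero, shift_zero]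
        · exact map_zero _
      · refine Finset.sum_congr rfl fun K _ => ?_
        split_ifs with h
        · rw [h, map_smul, map_mul, shift_neg_shift, mul_comm b]
        · exact map_zero _
    have h4 : ∑ K ∈ s, c K • (shift (-K) (φ * b) * (φ' * a)) = -(φ' * a * Q b) := by
      rw [Finset.mul_sum, ← Finset.sum_neg_distrib]
      refine Finset.sum_nbij' (fun K => -K) (fun K => -K) hs hs ?_ ?_ ?_ <;> intro K _
      · exact neg_neg K
      · exact neg_neg K
      · rw [hc, neg_smul, mul_neg, neg_neg, mul_smul_comm, mul_comm]
    rw [opVar]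
    simp only [h1]
    rw [Finset.sum_add_distrib, Finset.sum_ite_eq', if_pos h0, Finset.sum_comm]
    have h5 : ∀ K ∈ s, (∑ N ∈ n, if N = K then c K • (shift (-K) (φ * b) * (φ' * a)) else 0) =
        c K • (shift (-K) (φ * b) * (φ' * a)) := fun K hK => by
      rw [Finset.sum_ite_eq', if_pos (hsn hK)]
    rw [Finset.sum_congr rfl h5, h4]
    ring
  have hev : ∀ q : A, evolutionary q φ = q * φ' := by
    intro q
    rw [evolutionary_eq_sum (n := {0}) fun N hN => hφ N (by simpa using hN), Finset.sum_singleton,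
      shift_zero]
  -- At `q = P a = φ Q a` the first term is `φ φ' Qa Qb`, symmetric in `a` and `b`, so it cancels in
  -- the antisymmetrization; the second terms match `P` applied to `hV`.
  have hL : ∀ q b : A, opLin s p q b =
      q * φ' * Q b + φ * ∑ K ∈ s, c K • (shift K (q * φ') * shift K b) := by
    intro q b
    rw [opLin, Finset.mul_sum, Finset.mul_sum, ← Finset.sum_add_distrib]
    refine Finset.sum_congr rfl fun K hK => ?_
    rw [hp K hK, ← evolutionaryDer_apply, Derivation.map_smul, Derivation.leibniz,
      evolutionaryDer_apply, evolutionaryDer_apply, evolutionary_shift, hev]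
    simp only [smul_eq_mul, map_mul, Algebra.smul_def]
    ring
  have hQV : Q (φ' * (b * Q a - a * Q b)) =
      ∑ K ∈ s, c K • (shift K (φ * Q a * φ') * shift K b) -
        ∑ K ∈ s, c K • (shift K (φ * Q b * φ') * shift K a) := by
    rw [← Finset.sum_sub_distrib]
    refine Finset.sum_congr rfl fun K _ => ?_
    rw [← smul_sub, ← map_mul, ← map_mul, ← map_sub]
    congr 2
    ring
  rw [hV, hQ, hL, hL, hQV, hQ, hQ]
  ring

end Operators

/-! ## Embeddings -/

namespace IsEmbedding

variable {A B : Type*} [CommRing A] [Algebra ℂ A] [DifferenceAlgebra A]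
  [CommRing B] [Algebra ℂ B] [DifferenceAlgebra B] {ι : A →ₐ[ℂ] B}

theorem map_opSum (hι : IsEmbedding ι) (s : Finset (ℤ × ℤ)) (p : ℤ × ℤ → A) (a : A) :
    ι (opSum s p a) = opSum s (fun K => ι (p K)) (ι a) := by
  simp [opSum, hι.map_shift]

theorem map_opVar (hι : IsEmbedding ι) (n s : Finset (ℤ × ℤ)) (p : ℤ × ℤ → A) (a b : A) :
    ι (opVar n s p a b) = opVar n s (fun K => ι (p K)) (ι a) (ι b) := by
  simp [opVar, hι.map_shift, hι.map_pd]

theorem map_evolutionary (hι : IsEmbedding ι) (q a : A) :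
    ι (evolutionary q a) = evolutionary (ι q) (ι a) := by
  obtain ⟨n, hn⟩ := exists_finset_pd a
  rw [evolutionary_eq_sum hn, evolutionary_eq_sum (n := n), map_sum]
  · simp only [map_mul, hι.map_shift, hι.map_pd]
  · intro N hN
    rw [← hι.map_pd, hn N hN, map_zero]

theorem map_opLin (hι : IsEmbedding ι) (s : Finset (ℤ × ℤ)) (p : ℤ × ℤ → A) (q b : A) :
    ι (opLin s p q b) = opLin s (fun K => ι (p K)) (ι q) (ι b) := by
  simp [opLin, hι.map_shift, hι.map_evolutionary]

theorem map_firstOrderCoeff (hι : IsEmbedding ι) (f g : A) (K : ℤ × ℤ) :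
    ι (firstOrderCoeff f g K) = firstOrderCoeff (ι f) (ι g) K := by
  simp only [firstOrderCoeff]
  split_ifs <;> simp [hι.map_shift]

end IsEmbedding

section Classification

/-! ## The classification -/

variable {A B : Type*} [CommRing A] [Algebra ℂ A] [DifferenceAlgebra A]
  [Field B] [Algebra ℂ B] [DifferenceAlgebra B]

/-- `x` and `φ 𝓢^κ φ` have the same logarithmic derivative in every variable: `ψ` along `u_0`, `𝓢^κ
ψ` along `u_κ`, zero along all others. Hence their quotient is a constant. -/
theorem exists_eq_smul_mul_shift
    (hconst : ∀ a : B, (∀ N : ℤ × ℤ, pd N a = 0) → ∃ c : ℂ, a = algebraMap ℂ B c) {φ ψ x : B} (hφ0 : φ ≠ 0)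
    (hφ : IsFunctionOfGen φ) (hφψ : pd 0 φ = ψ * φ) {κ : ℤ × ℤ} (hκ : κ ≠ 0)
    (hx : ∀ N, N ≠ 0 → N ≠ κ → pd N x = 0) (hx0 : pd 0 x = ψ * x)
    (hxκ : pd 0 (shift (-κ) x) = ψ * shift (-κ) x) :
    ∃ c : ℂ, x = c • (φ * shift κ φ) := by
  have hy : φ * shift κ φ ≠ 0 := mul_ne_zero hφ0 ((shift_eq_zero_iff κ φ).not.2 hφ0)
  have hpdy : ∀ N : ℤ × ℤ, pd N (φ * shift κ φ) =
      φ * shift κ (pd (N - κ) φ) + shift κ φ * pd N φ := fun N => by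
    rw [Derivation.leibniz, pd_shift', smul_eq_mul, smul_eq_mul]
  have key : ∀ N : ℤ × ℤ, ∃ ρ : B,
      pd N x = ρ * x ∧ pd N (φ * shift κ φ) = ρ * (φ * shift κ φ) := by
    intro N
    by_cases h0 : N = 0
    · subst h0
      refine ⟨ψ, hx0, ?_⟩
      rw [hpdy, hφ (0 - κ) (sub_ne_zero.2 hκ.symm), map_zero, hφψ]
      ring
    by_cases hN : N = κ
    · subst hN
      refine ⟨shift N ψ, ?_, ?_⟩
      · rw [pd_shift', zero_sub, neg_neg] at hxκ
        have := congrArg (shift N) hxκ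
        rwa [map_mul, shift_shift_neg, shift_shift_neg] at this
      · rw [hpdy, sub_self, hφ N h0, hφψ, map_mul]
        ring
    · refine ⟨0, by rw [hx N h0 hN, zero_mul], ?_⟩
      rw [hpdy, hφ N h0, hφ _ (sub_ne_zero.2 hN), map_zero]
      ring
  obtain ⟨c, hc⟩ := hconst (x / (φ * shift κ φ)) fun N => by
    obtain ⟨ρ, h1, h2⟩ := key N
    rw [Derivation.leibniz_div, h1, h2, smul_eq_mul, smul_eq_mul, smul_eq_mul]
    ring
  refine ⟨c, ?_⟩
  rw [Algebra.smul_def, ← hc, div_mul_cancel₀ _ hy]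

/-- `hconst` and `hlog` are all that is needed from the theory of meromorphic functions. The common
`ψ = ∂ log p(v)/∂u` yields `φ`, and the same `φ` serves both coefficients, even if `p w = 0`. -/
theorem IsNearestNeighbour.exists_normalForm
    (hconst : ∀ a : B, (∀ N : ℤ × ℤ, pd N a = 0) → ∃ c : ℂ, a = algebraMap ℂ B c)
    (hlog : ∀ f ψ : B, f ≠ 0 → IsFunctionOfGen ψ → pd 0 f = ψ * f →
      ∃ φ : B, φ ≠ 0 ∧ IsFunctionOfGen φ ∧ pd 0 φ = ψ * φ)
    {ι : A →ₐ[ℂ] B} (hι : IsEmbedding ι) {s : Finset (ℤ × ℤ)}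
    {p : ℤ × ℤ → A} {v w : ℤ × ℤ} {ξ η : ℤ × ℤ →+ ℤ} (h : IsNearestNeighbour s p v w ξ η)
    (hv : p v ≠ 0) : ∃ (α β : ℂ) (φ : B), IsFunctionOfGen φ ∧
      ι (p v) = α • (φ * shift v φ) ∧ ι (p w) = β • (φ * shift w φ) := by
  have : IsDomain A := hι.injective.isDomain ι.toRingHom
  have hv0 : v ≠ 0 := fun h0 => by simpa [h0] using h.ξv
  have hw0 : w ≠ 0 := fun h0 => by simpa [h0] using h.ηw
  have hf : ι (p v) ≠ 0 := (map_ne_zero_iff ι hι.injective).2 hv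
  have hpd : ∀ N, N ≠ 0 → N ≠ v → pd N (ι (p v)) = 0 := fun N h1 h2 => by
    rw [← hι.map_pd, h.pd_coeff N h1 h2, map_zero]
  have hpdw : ∀ N, N ≠ 0 → N ≠ w → pd N (ι (p w)) = 0 := fun N h1 h2 => by
    rw [← hι.map_pd, h.swap.pd_coeff N h1 h2, map_zero]
  obtain ⟨p1, p2, p3⟩ := h.proportional
  replace p1 := congrArg ι p1
  replace p2 := congrArg ι p2
  replace p3 := congrArg ι p3
  simp only [map_mul, hι.map_shift, hι.map_pd] at p1 p2 p3
  generalize ι (p v) = f at *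
  generalize ι (p w) = g at *
  have hψ : ∀ x, x * pd 0 f = f * pd 0 x → pd 0 x = pd 0 f / f * x := by
    intro x hx
    field_simp
    linear_combination -hx
  have hfv : shift (-v) f ≠ 0 := (shift_eq_zero_iff _ _).not.2 hf
  -- `ψ` comes from `f`, which involves only `u_0` and `u_v`; but by `p1` it is also the logarithmic
  -- derivative of `𝓢^{-v} f`, which does not involve `u_v`.
  have hψu : IsFunctionOfGen (pd 0 f / f) := by
    intro N hN
    by_cases hNv : N = v
    · have e : pd 0 f / f = pd 0 (shift (-v) f) / shift (-v) f := by
        rw [hψ _ p1, mul_div_cancel_right₀ _ hfv]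
      have e2 : pd N (shift (-v) f) = 0 := by
        rw [hNv, pd_shift', hpd, map_zero]
        · intro h1
          have := congrArg ξ h1
          simp [h.ξv] at this
        · intro h1
          exact hv0 (by rwa [sub_neg_eq_add, add_eq_right] at h1)
      rw [e, Derivation.leibniz_div, pd_comm, e2]
      simp
    · rw [Derivation.leibniz_div, pd_comm, hpd N hN hNv]
      simp
  obtain ⟨φ, hφ0, hφ, hφψ⟩ :=
    hlog _ _ hf hψu (hψ f rfl)
  obtain ⟨α, hα⟩ := exists_eq_smul_mul_shift hconst hφ0 hφ hφψ hv0 hpd (hψ f rfl)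
    (hψ _ p1)
  obtain ⟨β, hβ⟩ := exists_eq_smul_mul_shift hconst hφ0 hφ hφψ hw0 hpdw (hψ g p3)
    (hψ _ p2)
  exact ⟨α, β, φ, hφ, hα, hβ⟩

/-- One finite set of variables serves all coefficients; it also contains the origin and the
neighbours, where the derivatives of a normal form live. -/
theorem exists_finset_firstOrderCoeff (f g : A) : ∃ n : Finset (ℤ × ℤ),
    0 ∈ n ∧ neighbours ⊆ n ∧ ∀ K N, N ∉ n → pd N (firstOrderCoeff f g K) = 0 := by
  choose m hm using fun a : A => exists_finset_pd a
  refine ⟨insert 0 (neighbours ∪ neighbours.biUnion fun K => m (firstOrderCoeff f g K)),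
    Finset.mem_insert_self _ _, fun K hK => by simp [hK], fun K N hN => ?_⟩
  by_cases hK : K ∈ neighbours
  · refine hm _ N fun h => hN ?_
    exact Finset.mem_insert_of_mem (Finset.mem_union_right _ (Finset.mem_biUnion.2 ⟨K, hK, h⟩))
  · rw [(isSkewCoeff_firstOrderCoeff f g).eq_zero K hK, map_zero]

end Classification

end DifferenceAlgebra

/-! ### The classification of Hamiltonian operators of first order -/

theorem mainTheorem3 (U : TopologicalSpace.Opens ℂ) [ConnectedSpace U]
    {A : Type*} [CommRing A] [Algebra ℂ A] [DifferenceAlgebra A]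
    (ι : A →ₐ[ℂ] MeromorphicFunctions U) (hι : DifferenceAlgebra.IsEmbedding ι) (f g : A) :
    DifferenceAlgebra.IsHamiltonian (DifferenceAlgebra.firstOrderOp f g) ↔
      ∃ (α β : ℂ) (φ : MeromorphicFunctions U),
        DifferenceAlgebra.IsFunctionOfGen φ ∧
        DifferenceAlgebra.firstOrderOp (ι f) (ι g) =
          DifferenceAlgebra.normalFormOp α β φ := by
  have hskew := isSkewCoeff_firstOrderCoeff f g
  obtain ⟨n, h0n, hsn, hn⟩ := exists_finset_firstOrderCoeff f g
  rw [isHamiltonian_iff hskew hn (opApply_firstOrderOp f g)]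
  simp only [normalFormOp_eq, firstOrderOp_inj]
  constructor
  · intro hI
    have : IsDomain A := hι.injective.isDomain ι.toRingHom
    have hconst := fun a : MeromorphicFunctions U =>
      MeromorphicFunctions.exists_eq_algebraMap (f := a)
    have hlog := fun f ψ : MeromorphicFunctions U =>
      MeromorphicFunctions.exists_isFunctionOfGen (f := f) (ψ := ψ)
    have hNN : IsNearestNeighbour neighbours (firstOrderCoeff f g) (1, 0) (0, 1)
        (AddMonoidHom.fst ℤ ℤ) (AddMonoidHom.snd ℤ ℤ) :=
      { skew := hskew
        jacobi := siteBracket_jacobi hskew hn hI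
        mem := fun K hK => by
          by_contra! h
          refine hK (hskew.eq_zero K ?_)
          simp only [neighbours, Finset.mem_insert, Finset.mem_singleton, not_or]
          exact ⟨h.1, h.2.2.1, h.2.2.2, h.2.1⟩
        ξv := rfl
        ξw := rfl
        ηv := rfl
        ηw := rfl
        ext_zero := fun K h1 h2 => Prod.ext h1 h2 }
    have e1 : firstOrderCoeff f g (1, 0) = f := by simp [firstOrderCoeff]
    have e2 : firstOrderCoeff f g (0, 1) = g := by simp [firstOrderCoeff]
    by_cases hf : f = 0
    · by_cases hg : g = 0
      · exact ⟨0, 0, 0, fun N _ => map_zero _, by simp [hf], by simp [hg]⟩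
      · obtain ⟨β, α, φ, hφ, hβ, hα⟩ := hNN.swap.exists_normalForm hconst hlog hι (by rwa [e2])
        rw [e1] at hα
        rw [e2] at hβ
        exact ⟨α, β, φ, hφ, hα, hβ⟩
    · obtain ⟨α, β, φ, hφ, hα, hβ⟩ := hNN.exists_normalForm hconst hlog hι (by rwa [e1])
      rw [e1] at hα
      rw [e2] at hβ
      exact ⟨α, β, φ, hφ, hα, hβ⟩
  · rintro ⟨α, β, φ, hφ, hα, hβ⟩ F G
    -- The identity uses only sums, products, shifts and partial derivatives, so it can be verified
    -- in the field where `φ` lives.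
    apply hι.injective
    rw [map_sub, hι.map_opSum, hι.map_opVar, hι.map_opLin, hι.map_opLin, hι.map_opSum,
      hι.map_opSum]
    simp only [hι.map_firstOrderCoeff]
    refine opSum_opVar_of_normalForm hφ hskew.neg_mem h0n hsn
      (c := fun K => K.1 * α + K.2 * β) (fun K => ?_) (fun K hK => ?_) _ _
    · simp only [Prod.fst_neg, Prod.snd_neg, Int.cast_neg]
      ring
    · rw [hα, hβ, firstOrderCoeff_normalForm α β φ hK]

end
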